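/- Let $p$ be a prime and $\zeta_p=e^{2\pi\sqrt{-1}/p}$. Let $V_n^{(p)}$ and $V_m^{(p)}$ be vector spaces over $\mathbb{F}_p$ of dimensions $n$ and $m$, each with a non-degenerate symmetric bilinear form $\langle\cdot,\cdot\rangle$, where $n\ge 4$ is even and $2\le m\le n/2$. For a set $A$ of vectors write $A^*=A\setminus\{0\}$. A function $f:V_n^{(p)}\to\mathbb{F}_p$ with Walsh transform $W_f(a)=\sum_{x}\zeta_p^{f(x)-\langle a,x\rangle}$ is bent if $|W_f(a)|=p^{n/2}$ for all $a$. Then $W_f(a)=\pm p^{n/2}\zeta_p^{f^*(a)}$ (always with sign $+$ if $p=2$), and this defines the dual $f^*$; $f$ is weakly regular with constant $\varepsilon_f\in\{\pm1\}$ if $W_f(a)=\varepsilon_f p^{n/2}\zeta_p^{f^*(a)}$ for all $a$, and regular if moreover $\varepsilon_f=1$. A function $F:V_n^{(p)}\to V_m^{(p)}$ is vectorial bent if all components $F_c(x)=\langle c,F(x)\rangle$, $c\ne0$, are bent, and vectorial dual-bent if moreover the duals $(F_c)^*$, $c\neq 0$, together with the zero function form an $m$-dimensional $\mathbb{F}_p$-vector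 space whose nonzero elements are bent. A vectorial dual-bent $F$ satisfies Condition A if there is a vectorial bent $F^*:V_n^{(p)}\to V_m^{(p)}$ with $(F_c)^*=(F^*)_c$ for all $c\ne0$, and all $F_c$, $c\neq 0$, are weakly regular with the same constant $\varepsilon=\varepsilon_{F_c}$. An association scheme on a nonempty finite set $X$ is a partition of $X\times X$ into nonempty relations, one of which is the identity relation $R_{id}$, that is closed under transposition and for which, for all relations $R_i,R_j,R_k$ of it, the number $p_{i,j}^{k}$ of $z$ with $(x,z)\in R_i$ and $(z,y)\in R_j$ is the same for all $(x,y)\in R_k$; it is $d$-class if it has $d$ relations besides $R_{id}$. It is amorphic if every partition of $X\times X$ that consists of $R_{id}$ and of unions of its non-identity relations is again an association scheme. Let $F:V_n^{(p)}\to V_m^{(p)}$ be any function, $I=F((V_n^{(p)})^*)$, $D_{F,i}=\{x:F(x)=i\}$, $R_{id}=\{(x,x):x\in V_n^{(p)}\}$ and $R_i=\{(x,y): x-y\in D_{F,i}^*\}$ for $i\in I$. **Theorem 1.** The following two statements are equivalent. (1) $F$ is a vectorial dual-bent function with Condition A. (2) For some $\varepsilon\in\{\pm1\}$, with $\varepsilon=1$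 if $p\ne3$: $\{R_{id},R_i, i\in I\}$ is an $|I|$-class amorphic association scheme with $|I|\ge3$, and for every $i\in I$ the intersection number is $$p_{i,i}^{id}=p^{n-m}-\varepsilon p^{\frac n2-m}+\delta_{F(0)}(i)\,(\varepsilon p^{\frac n2}-1),$$ where $\delta_{F(0)}(i)=1$ if $i=F(0)$ and $0$ otherwise. Moreover, for each $\varepsilon$, (1) holds with common constant $\varepsilon$ if and only if (2) holds with this $\varepsilon$; and if (1) or (2) holds with $\varepsilon$, then: (3) $I=V_m^{(p)}$ and $|I|=p^m$, except in the case $p=3$, $n=2m$ and $\varepsilon=-1$, in which $I=V_m^{(3)}\setminus\{F(0)\}$ and $|I|=3^m-1$. -/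

import Mathlib

namespace VDB

section Schemes

variable {X : Type*}

/-- The transpose of a relation. -/
def transpose (R : Set (X × X)) : Set (X × X) := {q | (q.2, q.1) ∈ R}

/-- For all `(x, y) ∈ T`, the number of `z` with `(x, z) ∈ R` and `(z, y) ∈ S` equals `k`:
the intersection number of `R` and `S` relative to `T` is well defined and equal to `k`. -/
def HasIntersectionNumber (R S T : Set (X × X)) (k : ℕ) : Prop :=
  ∀ x y : X, (x, y) ∈ T → {z : X | (x, z) ∈ R ∧ (z, y) ∈ S}.ncard = k

/-- A set `𝓡` of relations on `X` is an association scheme: its members are nonempty, partition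
`X × X`, include the identity relation, are permuted by transposition, and all intersection
numbers are well defined. -/
structure IsAssociationScheme (𝓡 : Set (Set (X × X))) : Prop where
  diagonal_mem : Set.diagonal X ∈ 𝓡
  isPartition : Setoid.IsPartition 𝓡
  transpose_mem : ∀ R ∈ 𝓡, transpose R ∈ 𝓡
  intersection : ∀ R ∈ 𝓡, ∀ S ∈ 𝓡, ∀ T ∈ 𝓡, ∃ k : ℕ, HasIntersectionNumber R S T k

/-- `𝓐` is a fusion of `𝓡`: a partition of `X × X` containing the identity relation, whose other
members are unions of non-identity members of `𝓡`. -/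
structure IsFusion (𝓡 𝓐 : Set (Set (X × X))) : Prop where
  isPartition : Setoid.IsPartition 𝓐
  diagonal_mem : Set.diagonal X ∈ 𝓐
  eq_sUnion : ∀ A ∈ 𝓐, A ≠ Set.diagonal X → ∃ 𝓢 ⊆ 𝓡 \ {Set.diagonal X}, A = ⋃₀ 𝓢

/-- `𝓡` is a `d`-class amorphic association scheme: an association scheme with `d` non-identity
relations, all of whose fusions are association schemes. -/
structure IsAmorphicScheme (d : ℕ) (𝓡 : Set (Set (X × X))) : Prop where
  isAssociationScheme : IsAssociationScheme 𝓡
  finite : 𝓡.Finite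
  ncard_eq : 𝓡.ncard = d + 1
  fusion : ∀ 𝓐 : Set (Set (X × X)), IsFusion 𝓡 𝓐 → IsAssociationScheme 𝓐

end Schemes

noncomputable section Bent

variable {p : ℕ} [Fact p.Prime]
variable {V : Type*} [AddCommGroup V] [Module (ZMod p) V] [Fintype V]
variable {W : Type*} [AddCommGroup W] [Module (ZMod p) W]

/-- The Walsh transform `a ↦ ∑ x, ζ ^ (f x - ⟨a, x⟩)`, where `ζ = exp (2 π i / p)`; note that
`ZMod.stdAddChar j = ζ ^ j`. -/
def walsh (B : LinearMap.BilinForm (ZMod p) V) (f : V → ZMod p) (a : V) : ℂ :=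
  ∑ x : V, ZMod.stdAddChar (f x - B a x)

variable (p V) in
/-- The number `p ^ (n / 2)` (real exponent), where `n` is the dimension of `V`. -/
def rootCard : ℝ := (p : ℝ) ^ ((Module.finrank (ZMod p) V : ℝ) / 2)

/-- `f` is a `p`-ary bent function. -/
def IsBent (B : LinearMap.BilinForm (ZMod p) V) (f : V → ZMod p) : Prop :=
  ∀ a : V, ‖walsh B f a‖ = rootCard p V

/-- The possible leading constants of normalized Walsh coefficients of `p`-ary bent functions in
dimension `n`: only `1` for `p = 2`; `± 1` for odd `p` if `p ≡ 1 mod 4` or `n` is even; and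
`± i` otherwise. -/
def signs (p n : ℕ) : Set ℂ :=
  if p = 2 then {1}
  else if p % 4 = 1 ∨ Even n then {1, -1}
  else {Complex.I, -Complex.I}

/-- The dual `f^*` of a bent function `f`: its value at `a` is the `j` such that
`W_f(a) = ξ p^(n/2) ζ^j` for some admissible sign `ξ` (unspecified if there is no such `j`, which
does not happen for bent `f`). -/
def dual (B : LinearMap.BilinForm (ZMod p) V) (f : V → ZMod p) (a : V) : ZMod p :=
  Classical.epsilon fun j : ZMod p =>
    ∃ ξ ∈ signs p (Module.finrank (ZMod p) V),
      walsh B f a = ξ * (rootCard p V : ℂ) * ZMod.stdAddChar j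

/-- `f` is a weakly regular bent function with `ε_f = ε`. -/
structure IsWeaklyRegular (B : LinearMap.BilinForm (ZMod p) V) (f : V → ZMod p) (ε : ℂ) :
    Prop where
  isBent : IsBent B f
  mem_signs : ε ∈ signs p (Module.finrank (ZMod p) V)
  walsh_eq : ∀ a : V, walsh B f a = ε * (rootCard p V : ℂ) * ZMod.stdAddChar (dual B f a)

/-- The component function `F_c(x) = ⟨c, F x⟩`. -/
def component (B' : LinearMap.BilinForm (ZMod p) W) (F : V → W) (c : W) : V → ZMod p :=
  fun x => B' c (F x)

/-- `F` is vectorial bent. -/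
def IsVectorialBent (B : LinearMap.BilinForm (ZMod p) V) (B' : LinearMap.BilinForm (ZMod p) W)
    (F : V → W) : Prop :=
  ∀ c : W, c ≠ 0 → IsBent B (component B' F c)

/-- `F` is vectorial dual-bent: it is vectorial bent and the duals of its components, together
with the zero function, form a vector space of bent functions of dimension `m = dim W`. -/
def IsVectorialDualBent (B : LinearMap.BilinForm (ZMod p) V)
    (B' : LinearMap.BilinForm (ZMod p) W) (F : V → W) : Prop :=
  IsVectorialBent B B' F ∧
    ∃ S : Submodule (ZMod p) (V → ZMod p),
      (S : Set (V → ZMod p)) = insert 0 {g | ∃ c : W, c ≠ 0 ∧ g = dual B (component B' F c)} ∧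
      Module.finrank (ZMod p) S = Module.finrank (ZMod p) W ∧
      ∀ g ∈ S, g ≠ 0 → IsBent B g

/-- `F` is vectorial dual-bent with Condition A and common constant `ε`: some vectorial dual `G`
of `F` satisfies `(F_c)^* = G_c` for all `c ≠ 0`, and every `F_c`, `c ≠ 0`, is weakly regular with
`ε_{F_c} = ε` (so all of them are regular, or all of them are weakly regular but not regular). -/
structure HasConditionAWith (B : LinearMap.BilinForm (ZMod p) V)
    (B' : LinearMap.BilinForm (ZMod p) W) (F : V → W) (ε : ℂ) : Prop where
  isVectorialDualBent : IsVectorialDualBent B B' F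
  exists_dual : ∃ G : V → W, IsVectorialBent B B' G ∧
    ∀ c : W, c ≠ 0 → dual B (component B' F c) = component B' G c
  isWeaklyRegular : ∀ c : W, c ≠ 0 → IsWeaklyRegular B (component B' F c) ε

/-- `F` is vectorial dual-bent with Condition A. -/
def HasConditionA (B : LinearMap.BilinForm (ZMod p) V)
    (B' : LinearMap.BilinForm (ZMod p) W) (F : V → W) : Prop :=
  ∃ ε : ℂ, HasConditionAWith B B' F ε

end Bent

noncomputable section Relations

variable {V W : Type*} [AddCommGroup V] [AddCommGroup W]

/-- The image `I` of the set of nonzero vectors under `F`. -/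
def imageStar (F : V → W) : Set W := F '' {x | x ≠ 0}

/-- The set `D_{F,i}^*` of nonzero vectors with `F x = i`. -/
def fiberStar (F : V → W) (i : W) : Set V := {x | F x = i} \ {0}

/-- The relation `R_i`. -/
def rel (F : V → W) (i : W) : Set (V × V) := {q | q.1 - q.2 ∈ fiberStar F i}

/-- The set of relations `{R_id, R_i, i ∈ I}`. -/
def relations (F : V → W) : Set (Set (V × V)) :=
  insert (Set.diagonal V) (rel F '' imageStar F)

/-- The relations form an `|I|`-class amorphic association scheme with `|I| ≥ 3` and, for `i ∈ I`,
`p_{i,i}^{id} = p^(n-m) - ε p^(n/2-m) + δ_{F(0)}(i) (ε p^(n/2) - 1)`, where `ε ∈ {1, -1}` and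
`ε = 1` if `p ≠ 3`. -/
structure IsPrescribedScheme (p n m : ℕ) (F : V → W) (ε : ℤ) : Prop where
  isAmorphicScheme : IsAmorphicScheme (imageStar F).ncard (relations F)
  three_le : 3 ≤ (imageStar F).ncard
  eps : ε = 1 ∨ ε = -1
  eps_eq_one : p ≠ 3 → ε = 1
  intersection : ∀ i ∈ imageStar F, ∃ k : ℕ,
    HasIntersectionNumber (rel F i) (rel F i) (Set.diagonal V) k ∧
    (k : ℤ) = (p : ℤ) ^ (n - m) - ε * (p : ℤ) ^ (n / 2 - m)
      + Set.indicator {F 0} 1 i * (ε * (p : ℤ) ^ (n / 2) - 1)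

end Relations

end VDB

/-!
Write `N = p ^ n`, `q = p ^ (n / 2)`, `M = p ^ m`, and let `G` be a candidate for the vectorial
dual of `F`. Condition A with constant `ε` says that the Walsh transform of each component `F_c`
with `c ≠ 0` is `ε q` times the corresponding character of `G`. As the nontrivial characters of
`W` span the functions of zero sum on `W`, this is the same as saying that, for each such function
`h`, the Fourier transform of `h ∘ F` is `ε q (h ∘ G)` (`IsDualPair`, `hasConditionAWith_iff`).
The theorem compares this notion with amorphic schemes.

From a dual pair to a scheme: the Fourier transform turns the convolution of `h ∘ F` and `k ∘ F`
into `N ((h k) ∘ G)`, which up to a constant is again `ε q` times the transform of a pullback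
along `F`. Hence the number of ways to write `u ≠ 0` as a sum of a vector over `J` and one over
`K` depends only on whether `F u ∈ J` and `F u ∈ K` (`IsDualPair.ncard_eq`), so that every fusion
is a scheme. The valencies follow from `F 0 = G 0`, which Parseval's identity gives if `M ≠ 2`
(`IsDualPair.map_zero`). For `p > 3` the sign is `1` because the integrality of the Fourier
coefficients makes the fibers of `F` stable under nonzero scalars, and then `p - 1` divides
`p ^ (n - m) - ε p ^ (n / 2 - m)`.

From a scheme to a dual pair: an amorphic scheme with at least three classes is symmetric, and
each union of classes is a strongly regular graph, so each class and each union of two classes has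
at most two eigenvalues at the nontrivial characters. Since the eigenvalues of two classes are
linearly independent modulo constants, exactly three of the four possible pairs of eigenvalues
occur, the difference of the two eigenvalues is the same for all classes, and the missing pair is
of the same kind for all pairs of classes. Thus the eigenvalues have the form
`t i + D * [G a = i]` for a function `G` (`exists_eq_add_ite`). The orthogonality relations give
`D = σ q` with `σ = ± 1` and `t i = - σ k i / (q - σ)`, where the `k i` are the valencies (`eigenvalue_parameters`),
and for the prescribed valencies these numbers are algebraic integers only if `σ = ε`.

The image of `F` is found by counting the nonzero vectors fiber by fiber
(`imageStar_of_valencies`).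
-/

namespace VDB

/-! ### The Fourier transform on `V` -/

noncomputable section FourierTransform

variable {p : ℕ} [Fact p.Prime]
variable {V : Type*} [AddCommGroup V] [Module (ZMod p) V] [Fintype V]

/-- The Fourier transform of a complex function on `V`, with characters indexed by `V` itself via
the bilinear form: `f ↦ (a ↦ ∑ x, f x * ζ ^ (- ⟨a, x⟩))`. -/
def fourier (B : LinearMap.BilinForm (ZMod p) V) : (V → ℂ) →ₗ[ℂ] (V → ℂ) where
  toFun f a := ∑ x, f x * ZMod.stdAddChar (-(B a x))
  map_add' f g := by
    funext a
    simp [add_mul, Finset.sum_add_distrib]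
  map_smul' c f := by
    funext a
    simp [Finset.mul_sum, mul_assoc]

/-- The convolution `u ↦ ∑ v, f v * g (u - v)`. -/
def conv (f g : V → ℂ) (u : V) : ℂ := ∑ v, f v * g (u - v)

/-- The complex indicator function of a set. -/
def ind {X : Type*} (D : Set X) : X → ℂ := D.indicator 1

theorem ind_of_notMem {X : Type*} {D : Set X} {x : X} (h : x ∉ D) : ind D x = 0 := by simp [ind, h]

open Classical in
theorem ind_apply {X : Type*} (D : Set X) (x : X) : ind D x = if x ∈ D then 1 else 0 := by
  simp [ind, Set.indicator_apply]

theorem sum_ind {X : Type*} [Fintype X] (D : Set X) : ∑ x, ind D x = D.ncard := by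
  classical
  simp [ind_apply, Finset.sum_boole, Set.ncard_eq_toFinset_card']

/-- The convolution of two indicator functions counts representations as a sum. -/
theorem conv_ind {X : Type*} [AddCommGroup X] [Fintype X] (C D : Set X) (u : X) :
    conv (ind C) (ind D) u = ({v | v ∈ C ∧ u - v ∈ D}.ncard : ℂ) := by
  classical
  rw [conv, ← sum_ind]
  refine Finset.sum_congr rfl fun v _ => ?_
  by_cases h : v ∈ C <;> by_cases h' : u - v ∈ D <;> simp [ind_apply, h, h']

variable {B : LinearMap.BilinForm (ZMod p) V}

theorem fourier_apply (f : V → ℂ) (a : V) :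
    fourier B f a = ∑ x, f x * ZMod.stdAddChar (-(B a x)) := rfl

theorem walsh_eq_fourier (f : V → ZMod p) (a : V) :
    walsh B f a = fourier B (fun x => ZMod.stdAddChar (f x)) a := by
  simp [walsh, fourier_apply, sub_eq_add_neg, AddChar.map_add_eq_mul]

/-- Orthogonality of characters. -/
theorem sum_stdAddChar (hB : B.Nondegenerate) [DecidableEq V] (x : V) :
    ∑ a, (ZMod.stdAddChar (B a x) : ℂ) = if x = 0 then (Fintype.card V : ℂ) else 0 := by
  classical
  let ψ : AddChar V ℂ := ZMod.stdAddChar.compAddMonoidHom (B.flip x).toAddMonoidHom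
  have hψ : ∀ a, ψ a = ZMod.stdAddChar (B a x) := fun a => rfl
  simp_rw [← hψ]
  rw [AddChar.sum_eq_ite]
  have : ψ = 0 ↔ x = 0 := by
    constructor
    · intro h
      refine hB.2 x fun a => ?_
      have h1 : ψ a = 1 := by rw [h]; rfl
      rw [hψ, ← AddChar.map_zero_eq_one (ZMod.stdAddChar (N := p))] at h1
      exact ZMod.injective_stdAddChar h1
    · rintro rfl
      ext a
      simp [hψ]
  simp [this]

theorem fourier_inversion (hB : B.Nondegenerate) (f : V → ℂ) (x : V) :
    ∑ a, fourier B f a * ZMod.stdAddChar (B a x) = Fintype.card V * f x := by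
  classical
  simp_rw [fourier_apply, Finset.sum_mul]
  rw [Finset.sum_comm]
  have : ∀ y, ∑ a, f y * ZMod.stdAddChar (-(B a y)) * ZMod.stdAddChar (B a x)
      = if x = y then Fintype.card V * f y else 0 := by
    intro y
    have h := sum_stdAddChar hB (x - y)
    calc _ = f y * ∑ a, (ZMod.stdAddChar (B a (x - y)) : ℂ) := by
          rw [Finset.mul_sum]
          refine Finset.sum_congr rfl fun a _ => ?_
          rw [map_sub, sub_eq_neg_add, AddChar.map_add_eq_mul, mul_assoc]
      _ = _ := by
          rw [h]
          by_cases hxy : x = y <;> simp [hxy, sub_eq_zero, mul_comm]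
  simp [this]

theorem fourier_injective (hB : B.Nondegenerate) : Function.Injective (fourier B) := by
  intro f g h
  funext x
  have h1 := fourier_inversion hB f x
  rw [h, fourier_inversion hB g x] at h1
  have : (Fintype.card V : ℂ) ≠ 0 := by simp
  exact (mul_left_cancel₀ this h1).symm

theorem fourier_conv (f g : V → ℂ) (a : V) :
    fourier B (conv f g) a = fourier B f a * fourier B g a := by
  simp_rw [fourier_apply, conv, Finset.sum_mul_sum, Finset.sum_mul]
  rw [Finset.sum_comm]
  refine Finset.sum_congr rfl fun v _ => ?_
  rw [← Equiv.sum_comp (Equiv.addLeft v)]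
  refine Finset.sum_congr rfl fun u _ => ?_
  simp only [Equiv.coe_addLeft, add_sub_cancel_left, map_add, neg_add, AddChar.map_add_eq_mul]
  ring

/-- Parseval's identity in bilinear form, without complex conjugation. -/
theorem parseval (hB : B.Nondegenerate) (f g : V → ℂ) :
    ∑ a, fourier B f a * fourier B g a = Fintype.card V * ∑ x, f x * g (-x) := by
  have h := fourier_inversion hB (conv f g) 0
  simpa [fourier_conv, conv] using h

open Classical in
theorem fourier_one (hB : B.Nondegenerate) (hs : B.IsSymm) (a : V) :
    fourier B 1 a = if a = 0 then (Fintype.card V : ℂ) else 0 := by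
  have h := sum_stdAddChar hB (-a)
  simp only [neg_eq_zero] at h
  rw [← h, fourier_apply]
  refine Finset.sum_congr rfl fun x _ => ?_
  simp [hs.eq a x]

theorem fourier_ind_zero (a : V) : fourier B (ind {0}) a = 1 := by
  classical
  simp [fourier_apply, ind_apply]

theorem fourier_zero_right (f : V → ℂ) : fourier B f 0 = ∑ x, f x := by
  simp [fourier_apply]

theorem fourier_neg_arg (f : V → ℂ) (a : V) :
    fourier B (fun x => f (-x)) a = fourier B f (-a) := by
  simp only [fourier_apply]
  rw [← Equiv.sum_comp (Equiv.neg V)]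
  simp

theorem fourier_conj (f : V → ℂ) (hf : ∀ x, (starRingEnd ℂ) (f x) = f x) (a : V) :
    (starRingEnd ℂ) (fourier B f a) = fourier B f (-a) := by
  simp [fourier_apply, map_sum, map_mul, ← AddChar.map_neg_eq_conj, hf]

/-- The indicator function of a set closed under negation has real Fourier transform. -/
theorem conj_fourier_ind_of_neg_mem {D : Set V} (hD : ∀ x, -x ∈ D ↔ x ∈ D) (a : V) :
    (starRingEnd ℂ) (fourier B (ind D) a) = fourier B (ind D) a := by
  classical
  have h : (fun x => ind D (-x)) = ind D := by
    funext x
    simp [ind_apply, hD]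
  rw [fourier_conj _ (fun x => by by_cases h : x ∈ D <;> simp [ind_apply, h]), ← fourier_neg_arg, h]

end FourierTransform

/-! ### Dual pairs -/

noncomputable section DualPairs

variable {p : ℕ} [Fact p.Prime]
variable {V : Type*} [AddCommGroup V] [Module (ZMod p) V] [Fintype V]
variable {W : Type*} [Fintype W]
variable {B : LinearMap.BilinForm (ZMod p) V} {F G : V → W} {κ : ℝ}

/-- `F` and `G` are dual to each other with real factor `κ`: pulling back a function of zero sum
along `F` and taking the Fourier transform gives `κ` times the pullback of the same function along
`G`. Taking nontrivial characters of `W` for `h`, this says that the Walsh transforms of the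
components of `F` are `κ` times the characters of the components of `G`. -/
def IsDualPair (B : LinearMap.BilinForm (ZMod p) V) (F G : V → W) (κ : ℝ) : Prop :=
  ∀ h : W → ℂ, ∑ w, h w = 0 → ∀ a, fourier B (h ∘ F) a = κ * h (G a)

/-- The indicator function of a set, shifted by a constant so as to have zero sum. -/
def bal (J : Set W) (w : W) : ℂ := ind J w - J.ncard / Fintype.card W

theorem sum_bal [Nonempty W] (J : Set W) : ∑ w, bal J w = 0 := by
  have : (Fintype.card W : ℂ) ≠ 0 := by simp
  simp [bal, Finset.sum_sub_distrib, sum_ind, mul_div_cancel₀ _ this]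

theorem conj_bal (J : Set W) (w : W) : (starRingEnd ℂ) (bal J w) = bal J w := by
  classical
  by_cases h : w ∈ J <;> simp [bal, ind_apply, h]

theorem bal_eq_bal {J : Set W} {v w : W} : bal J v = bal J w ↔ (v ∈ J ↔ w ∈ J) := by
  classical
  simp only [bal, sub_left_inj]
  by_cases h : v ∈ J <;> by_cases h' : w ∈ J <;> simp [ind_apply, h, h']

/-- The function `bal {i}` has two values, hence satisfies a quadratic equation. -/
theorem bal_singleton_sq [Nonempty W] (i w : W) :
    bal {i} w ^ 2 = (1 - 2 / Fintype.card W) * bal {i} w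
      + (1 / Fintype.card W) * (1 - 1 / Fintype.card W) := by
  classical
  have : (Fintype.card W : ℂ) ≠ 0 := by simp
  by_cases h : w = i <;> simp [bal, ind_apply, h] <;> field_simp <;> ring

theorem eq_sum_bal (h : W → ℂ) (h0 : ∑ w, h w = 0) (v : W) : h v = ∑ i, h i * bal {i} v := by
  classical
  simp [bal, ind_apply, mul_sub, Finset.sum_sub_distrib, ← Finset.sum_mul, h0]

/-- Every function of zero sum is a combination of the functions `bal {i}`, so duality need only be
checked for these. -/
theorem isDualPair_of_bal
    (H : ∀ i a, fourier B (bal {i} ∘ F) a = κ * bal {i} (G a)) : IsDualPair B F G κ := by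
  intro h h0 a
  have : h ∘ F = ∑ i, h i • (bal {i} ∘ F) := by
    funext x
    simp [eq_sum_bal h h0 (F x)]
  rw [this, eq_sum_bal h h0 (G a)]
  simp only [map_sum, map_smul, Finset.sum_apply, Pi.smul_apply, H, smul_eq_mul, Finset.mul_sum]
  refine Finset.sum_congr rfl fun i _ => ?_
  ring

namespace IsDualPair

theorem sum_comp (H : IsDualPair B F G κ) (h : W → ℂ) (h0 : ∑ w, h w = 0) :
    ∑ x, h (F x) = κ * h (G 0) := by
  have := H h h0 0
  rwa [fourier_zero_right] at this

variable [Nonempty W]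

/-- `F` is even, because the pullbacks of real functions have real Fourier transform. -/
theorem map_neg (H : IsDualPair B F G κ) (hB : B.Nondegenerate) (x : V) : F (-x) = F x := by
  set i := F x with hi
  have h : fourier B (fun x => (bal {i} ∘ F) (-x)) = fourier B (bal {i} ∘ F) := by
    funext a
    have h2 := fourier_conj (B := B) (bal {i} ∘ F) (fun x => conj_bal _ _) a
    rw [fourier_neg_arg, ← h2, H _ (sum_bal _)]
    simp [conj_bal]
  have h1 : bal {i} (F (-x)) = bal {i} (F x) := congrFun (fourier_injective hB h) x
  rw [bal_eq_bal] at h1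
  exact h1.2 hi.symm

/-- Duality is symmetric, by Fourier inversion. -/
theorem symm (H : IsDualPair B F G κ) (hB : B.Nondegenerate) (hs : B.IsSymm)
    (hκ : κ ^ 2 = Fintype.card V) : IsDualPair B G F κ := by
  intro h h0 a
  have h1 := fourier_inversion hB (h ∘ F) (-a)
  have hκ0 : (κ : ℂ) ≠ 0 := by
    intro h
    have : κ = 0 := by exact_mod_cast h
    rw [this] at hκ
    have : (Fintype.card V : ℝ) ≠ 0 := by simp
    exact this (by simpa using hκ.symm)
  have hκ' : (κ : ℂ) ^ 2 = Fintype.card V := by exact_mod_cast hκ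
  simp only [H h h0, mul_assoc, ← Finset.mul_sum] at h1
  rw [← hκ', pow_two, mul_assoc] at h1
  have h2 := mul_left_cancel₀ hκ0 h1
  rw [Function.comp_apply, H.map_neg hB] at h2
  rw [← h2, fourier_apply]
  refine Finset.sum_congr rfl fun x _ => ?_
  simp [hs.eq a x]

/-- Dual functions agree at the origin: Parseval's identity shows that the fibers of `F` and `G`
over a point have equal size, and that size depends on the value at the origin of the other
function. -/
theorem map_zero (H : IsDualPair B F G κ) (hB : B.Nondegenerate) (hs : B.IsSymm)
    (hκ : κ ^ 2 = Fintype.card V) (hW : 2 < Fintype.card W) : G 0 = F 0 := by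
  have hN : (Fintype.card V : ℂ) ≠ 0 := by simp
  have hκ' : (κ : ℂ) ^ 2 = Fintype.card V := by exact_mod_cast hκ
  have hκ0 : (κ : ℂ) ≠ 0 := by
    intro h
    rw [h] at hκ'
    exact hN (by simpa using hκ'.symm)
  set i := F 0 with hi
  set h : W → ℂ := bal {i} with hh
  have h0 : ∑ w, h w = 0 := sum_bal _
  have h1 := parseval hB (h ∘ F) (h ∘ F)
  have h2 : ∑ a, h (G a) ^ 2 = ∑ x, h (F x) ^ 2 := by
    apply mul_left_cancel₀ hN
    rw [← hκ', Finset.mul_sum, hκ']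
    calc _ = ∑ a, fourier B (h ∘ F) a * fourier B (h ∘ F) a := by
          refine Finset.sum_congr rfl fun a _ => ?_
          rw [H h h0, ← hκ']
          ring
      _ = _ := by
          rw [h1]
          simp [H.map_neg hB, pow_two]
  simp only [hh, bal_singleton_sq, Finset.sum_add_distrib, ← Finset.mul_sum] at h2
  rw [add_left_inj, H.sum_comp _ (sum_bal _), (H.symm hB hs hκ).sum_comp _ (sum_bal _)] at h2
  have hM : (1 - 2 / Fintype.card W : ℂ) ≠ 0 := by
    have hc : (Fintype.card W : ℂ) ≠ 0 := by simp
    rw [sub_ne_zero, ne_eq, eq_div_iff hc, one_mul]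
    intro h
    have : Fintype.card W = 2 := by exact_mod_cast h
    omega
  have h3 := mul_left_cancel₀ hκ0 (mul_left_cancel₀ hM h2)
  rw [bal_eq_bal] at h3
  exact h3.1 hi.symm

/-- The convolution of pullbacks along `F` of functions of zero sum is, away from the origin, again
a pullback along `F`. -/
theorem conv_comp (H : IsDualPair B F G κ) (hB : B.Nondegenerate)
    (hκ : κ ^ 2 = Fintype.card V) {h k : W → ℂ} (h0 : ∑ w, h w = 0) (k0 : ∑ w, k w = 0)
    {u : V} (hu : u ≠ 0) :
    conv (h ∘ F) (k ∘ F) u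
      = κ * (h (F u) * k (F u) - (∑ w, h w * k w) / Fintype.card W) := by
  have hκ' : (κ : ℂ) ^ 2 = Fintype.card V := by exact_mod_cast hκ
  set c : ℂ := (∑ w, h w * k w) / Fintype.card W with hc
  set l : W → ℂ := fun w => h w * k w - c with hl
  have l0 : ∑ w, l w = 0 := by
    have : (Fintype.card W : ℂ) ≠ 0 := by simp
    simp [hl, hc, Finset.sum_sub_distrib, mul_div_cancel₀ _ this]
  have h1 : fourier B (conv (h ∘ F) (k ∘ F))
      = fourier B ((κ : ℂ) • (l ∘ F) + ((κ : ℂ) ^ 2 * c) • ind {0}) := by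
    funext a
    rw [fourier_conv, H h h0, H k k0, map_add, map_smul, map_smul, Pi.add_apply, Pi.smul_apply,
      Pi.smul_apply, H l l0, fourier_ind_zero]
    simp only [hl, smul_eq_mul]
    ring
  have h2 := congrFun (fourier_injective hB h1) u
  rw [h2]
  simp [hl, ind, hu]

end IsDualPair

/-- The effect on a convolution of adding constants and multiples of the indicator function of the
origin to both factors. -/
theorem conv_expand {X : Type*} [AddCommGroup X] [Fintype X] (f g : X → ℂ) (α β γ η : ℂ) (u : X) :
    conv (fun x => f x + α + γ * ind {0} x) (fun x => g x + β + η * ind {0} x) u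
      = conv f g u + β * ∑ x, f x + η * f u + α * ∑ x, g x + α * β * Fintype.card X + α * η
        + γ * g u + γ * β + γ * η * ind {0} u := by
  classical
  have h1 : ∑ v, g (u - v) = ∑ v, g v := Equiv.sum_comp (Equiv.subLeft u) g
  have h2 : ∀ v : X, ind {0} (u - v) = if v = u then (1 : ℂ) else 0 := by
    intro v
    simp [ind_apply, sub_eq_zero, eq_comm]
  have h3 : ∀ v : X, ind {0} v = if v = 0 then (1 : ℂ) else 0 := by
    intro v
    simp [ind_apply]
  have e : ∀ v, (f v + α + γ * ind {0} v) * (g (u - v) + β + η * ind {0} (u - v))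
      = f v * g (u - v) + β * f v + (if v = u then η * f v else 0) + α * g (u - v) + α * β
        + (if v = u then α * η else 0) + (if v = 0 then γ * g (u - v) else 0)
        + (if v = 0 then γ * β else 0) + (if v = 0 then γ * η * ind {0} (u - v) else 0) := by
    intro v
    rw [h2, h3]
    split_ifs <;> ring
  simp only [conv, e, Finset.sum_add_distrib, Finset.sum_ite_eq', Finset.mem_univ, if_true,
    ← Finset.mul_sum, h1, Finset.sum_const, Finset.card_univ, nsmul_eq_mul, sub_zero]
  ring

/-- The set of nonzero vectors that `F` maps into `J`. -/
def fiberUnion {X Y : Type*} [Zero X] (F : X → Y) (J : Set Y) : Set X := {x | x ≠ 0 ∧ F x ∈ J}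

theorem ind_fiberUnion {X : Type*} [Zero X] (F : X → W) (J : Set W) (x : X) :
    ind (fiberUnion F J) x
      = (bal J ∘ F) x + J.ncard / Fintype.card W + (-ind J (F 0)) * ind {0} x := by
  classical
  by_cases hx : x = 0
  · by_cases h : F 0 ∈ J <;> simp [bal, ind_apply, fiberUnion, hx, h]
  · by_cases h : F x ∈ J <;> simp [bal, ind_apply, fiberUnion, hx, h]

/-- The number of ways to write `u` as a sum of a vector over `J` and a vector over `K` depends
only on whether `F u` lies in `J` and in `K`. -/
theorem IsDualPair.ncard_eq [Nonempty W] (H : IsDualPair B F G κ) (hB : B.Nondegenerate)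
    (hκ : κ ^ 2 = Fintype.card V) (J K : Set W) {u u' : V} (hu : u ≠ 0) (hu' : u' ≠ 0)
    (hJ : F u ∈ J ↔ F u' ∈ J) (hK : F u ∈ K ↔ F u' ∈ K) :
    {v | v ∈ fiberUnion F J ∧ u - v ∈ fiberUnion F K}.ncard
      = {v | v ∈ fiberUnion F J ∧ u' - v ∈ fiberUnion F K}.ncard := by
  have h : conv (ind (fiberUnion F J)) (ind (fiberUnion F K)) u
      = conv (ind (fiberUnion F J)) (ind (fiberUnion F K)) u' := by
    rw [funext (ind_fiberUnion F J), funext (ind_fiberUnion F K), conv_expand, conv_expand,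
      H.conv_comp hB hκ (sum_bal _) (sum_bal _) hu, H.conv_comp hB hκ (sum_bal _) (sum_bal _) hu']
    simp only [Function.comp_apply, bal_eq_bal.2 hJ, bal_eq_bal.2 hK]
    simp [ind, hu, hu']
  rw [conv_ind, conv_ind] at h
  exact_mod_cast h

/-- Only the fiber over the value of `G` at the origin differs in size from the others. -/
theorem IsDualPair.ncard_fiber [Nonempty W] (H : IsDualPair B F G κ) (i : W) :
    ((F ⁻¹' {i}).ncard : ℂ) = (Fintype.card V - κ) / Fintype.card W + κ * ind {i} (G 0) := by
  have h := H.sum_comp (bal {i}) (sum_bal _)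
  have h1 : ∑ x, ind {i} (F x) = ((F ⁻¹' {i}).ncard : ℂ) := by
    rw [← sum_ind]
    rfl
  simp only [bal, Finset.sum_sub_distrib, h1, Set.ncard_singleton, Finset.sum_const,
    Finset.card_univ, nsmul_eq_mul] at h
  linear_combination h

end DualPairs

/-! ### Integral character sums and scalar multiplication -/

section Rationality

variable {p : ℕ} [Fact p.Prime]

theorem isPrimitiveRoot_stdAddChar_one :
    IsPrimitiveRoot (ZMod.stdAddChar (1 : ZMod p) : ℂ) p := by
  have h := ZMod.stdAddChar_coe (N := p) 1
  have h1 := Complex.isPrimitiveRoot_exp p (NeZero.ne p)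
  simp only [Int.cast_one, mul_one] at h
  rwa [h]

/-- Up to scaling, the only integral linear relation between the `p`-th roots of unity is that
their sum vanishes. -/
theorem eq_of_sum_mul_stdAddChar_eq_zero (n : ZMod p → ℤ)
    (h : ∑ j, (n j : ℂ) * ZMod.stdAddChar j = 0) (i j : ZMod p) : n i = n j := by
  have hp : 2 ≤ p := (Fact.out : p.Prime).two_le
  set ζ : ℂ := ZMod.stdAddChar (1 : ZMod p) with hζ
  have hprim : IsPrimitiveRoot ζ p := isPrimitiveRoot_stdAddChar_one
  have hpow : ∀ k : ℕ, (ZMod.stdAddChar (k : ZMod p) : ℂ) = ζ ^ k := by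
    intro k
    rw [hζ, ← AddChar.map_nsmul_eq_pow]
    simp
  have hsum : ∀ f : ZMod p → ℂ, ∑ j, f j = ∑ k ∈ Finset.range p, f (k : ZMod p) := by
    intro f
    refine Finset.sum_nbij' (fun j => j.val) (fun k => (k : ZMod p)) ?_ ?_ ?_ ?_ ?_
    · intro j _
      simpa using ZMod.val_lt j
    · simp
    · simp
    · intro k hk
      exact ZMod.val_cast_of_lt (by simpa using hk)
    · simp
  -- Subtracting a multiple of the cyclotomic polynomial lowers the degree below `p - 1`.
  set P : Polynomial ℚ := ∑ k ∈ Finset.range (p - 1),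
    Polynomial.C ((n k - n ((p - 1 : ℕ) : ZMod p) : ℤ) : ℚ) * Polynomial.X ^ k with hP
  have hcyc : ∑ k ∈ Finset.range p, ζ ^ k = 0 := hprim.geom_sum_eq_zero (by omega)
  have hroot : Polynomial.aeval ζ P = 0 := by
    rw [hsum] at h
    have e : ∑ k ∈ Finset.range p, ((n k - n ((p - 1 : ℕ) : ZMod p) : ℤ) : ℂ) * ζ ^ k = 0 := by
      simp only [hpow] at h
      push_cast
      simp only [sub_mul, Finset.sum_sub_distrib, h, ← Finset.mul_sum, hcyc]
      simp
    obtain ⟨r, hr⟩ : ∃ r, p = r + 1 := ⟨p - 1, by omega⟩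
    have hr' : p - 1 = r := by omega
    rw [hr'] at e
    rw [show Finset.range p = Finset.range (r + 1) by rw [← hr], Finset.sum_range_succ] at e
    rw [hP, hr']
    simpa using e
  have hdeg : P.degree < (p - 1 : ℕ) := by
    refine (Polynomial.degree_sum_le _ _).trans_lt ?_
    rw [Finset.sup_lt_iff (WithBot.bot_lt_coe _)]
    intro k hk
    refine (Polynomial.degree_C_mul_X_pow_le _ _).trans_lt ?_
    exact_mod_cast Finset.mem_range.1 hk
  have hP0 : P = 0 := by
    by_contra hne
    have h1 := minpoly.degree_le_of_ne_zero ℚ ζ hne hroot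
    rw [← Polynomial.cyclotomic_eq_minpoly_rat hprim (by omega), Polynomial.degree_cyclotomic,
      Nat.totient_prime Fact.out] at h1
    exact absurd (h1.trans_lt hdeg) (lt_irrefl _)
  have key : ∀ k : ZMod p, n k = n ((p - 1 : ℕ) : ZMod p) := by
    intro k
    rw [← ZMod.natCast_zmod_val k]
    rcases Nat.lt_or_ge k.val (p - 1) with hk | hk
    · have := congrArg (fun Q => Polynomial.coeff Q k.val) hP0
      simp only [hP, Polynomial.finsetSum_coeff, Polynomial.coeff_C_mul_X_pow,
        Finset.sum_ite_eq, Finset.mem_range, hk, if_true, Polynomial.coeff_zero] at this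
      have h2 : n (k.val : ZMod p) - n ((p - 1 : ℕ) : ZMod p) = 0 := by exact_mod_cast this
      linarith
    · have := ZMod.val_lt k
      rw [show k.val = p - 1 by omega]
  rw [key i, key j]

variable {V : Type*} [AddCommGroup V] [Module (ZMod p) V] [Fintype V]

/-- A set whose indicator function has integral Fourier transform is closed under multiplication
by nonzero scalars. -/
theorem smul_mem_iff_of_fourier_int {B : LinearMap.BilinForm (ZMod p) V} (hB : B.Nondegenerate)
    {D : Set V} (hD : ∀ a, ∃ r : ℤ, fourier B (ind D) a = r) {t : ZMod p} (ht : t ≠ 0) (x : V) :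
    t • x ∈ D ↔ x ∈ D := by
  classical
  have hsplit : ∀ (s : ZMod p) (a : V), ∑ x, ind D x * ZMod.stdAddChar (s * B a x)
      = ∑ j : ZMod p, (({x | x ∈ D ∧ B a x = j}.ncard : ℤ) : ℂ) * ZMod.stdAddChar (s * j) := by
    intro s a
    rw [← Finset.sum_fiberwise Finset.univ (fun x => B a x)]
    refine Finset.sum_congr rfl fun j _ => ?_
    rw [Int.cast_natCast, ← sum_ind, Finset.sum_mul, Finset.sum_filter]
    refine Finset.sum_congr rfl fun x _ => ?_
    by_cases h1 : x ∈ D <;> by_cases h2 : B a x = j <;> simp [ind_apply, h1, h2]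
  have hconst : ∀ a : V, ∀ i j : ZMod p, i ≠ 0 → j ≠ 0 →
      {x | x ∈ D ∧ B a x = i}.ncard = {x | x ∈ D ∧ B a x = j}.ncard := by
    intro a i j hi hj
    obtain ⟨r, hr⟩ := hD (-a)
    have h1 := hsplit 1 a
    have h2 : ∑ x, ind D x * ZMod.stdAddChar (1 * B a x) = (r : ℂ) := by
      rw [← hr, fourier_apply]
      simp
    rw [h2] at h1
    have h3 := eq_of_sum_mul_stdAddChar_eq_zero
      (fun j : ZMod p => ({x | x ∈ D ∧ B a x = j}.ncard : ℤ) - if j = 0 then r else 0)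
      (by
        simp only [one_mul] at h1
        simp [sub_mul, Finset.sum_sub_distrib, h1]) i j
    simpa [hi, hj] using h3
  have hscale : ∀ a : V, fourier B (ind D) (t • a) = fourier B (ind D) a := by
    intro a
    have h1 := hsplit (-t) a
    have h2 := hsplit (-1) a
    have e1 : fourier B (ind D) (t • a) = ∑ x, ind D x * ZMod.stdAddChar (-t * B a x) := by
      simp [fourier_apply]
    have e2 : fourier B (ind D) a = ∑ x, ind D x * ZMod.stdAddChar (-1 * B a x) := by
      simp [fourier_apply]
    rw [e1, e2, h1, h2]
    refine Eq.trans ?_ (Equiv.sum_comp (Equiv.mulLeft₀ t ht) (fun j : ZMod p =>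
      (({x | x ∈ D ∧ B a x = j}.ncard : ℤ) : ℂ) * ZMod.stdAddChar (-1 * j)))
    refine Finset.sum_congr rfl fun j _ => ?_
    have h3 : {x | x ∈ D ∧ B a x = j}.ncard = {x | x ∈ D ∧ B a x = t * j}.ncard := by
      by_cases hj : j = 0
      · simp [hj]
      · exact hconst a _ _ hj (mul_ne_zero ht hj)
    simp [h3]
  have hg : fourier B (fun x => ind D (t • x)) = fourier B (ind D) := by
    funext a
    obtain ⟨b, rfl⟩ : ∃ b, a = t • b := ⟨t⁻¹ • a, (smul_inv_smul₀ ht a).symm⟩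
    rw [hscale, fourier_apply, fourier_apply]
    refine Eq.trans ?_ (Equiv.sum_comp (LinearEquiv.smulOfNeZero (ZMod p) V t ht).toEquiv
      (fun x => ind D x * ZMod.stdAddChar (-(B b x))))
    simp
  have h1 := congrFun (fourier_injective hB hg) x
  by_cases h2 : x ∈ D <;> by_cases h3 : t • x ∈ D <;> simp [ind_apply, h2, h3] at h1 ⊢

omit [Fintype V] in
/-- The nonzero scalars act freely on the nonzero vectors. -/
theorem sub_one_dvd_ncard {D : Set V} (h0 : (0 : V) ∉ D)
    (hD : ∀ t : ZMod p, t ≠ 0 → ∀ x, t • x ∈ D ↔ x ∈ D) : p - 1 ∣ D.ncard := by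
  let S : SubMulAction (ZMod p)ˣ V :=
    { carrier := D
      smul_mem' := fun t x hx => (hD t t.ne_zero x).2 hx }
  have hfree : ∀ b : S, MulAction.stabilizer (ZMod p)ˣ b = ⊥ := by
    rintro ⟨x, hx⟩
    rw [eq_bot_iff]
    intro t ht
    have h1 : (t : ZMod p) • x = x := congrArg Subtype.val (MulAction.mem_stabilizer_iff.1 ht)
    have hx0 : x ≠ 0 := fun h => h0 (h ▸ hx)
    have h2 : ((t : ZMod p) - 1) • x = 0 := by rw [sub_smul, h1, one_smul, sub_self]
    rcases smul_eq_zero.1 h2 with h3 | h3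
    · rw [Subgroup.mem_bot]
      ext
      simpa [sub_eq_zero] using h3
    · exact absurd h3 hx0
  have h := Nat.card_congr (MulAction.selfEquivOrbitsQuotientProd hfree)
  rw [Nat.card_prod, Nat.card_eq_fintype_card (α := (ZMod p)ˣ), ZMod.card_units] at h
  exact ⟨_, by rw [mul_comm]; exact h⟩

end Rationality

/-! ### Translation-invariant relations and fusions -/

section CayleyRelations

variable {V W : Type*} [AddCommGroup V]

/-- The translation-invariant relation with connection set `E`. -/
def cay (E : Set V) : Set (V × V) := {q | q.1 - q.2 ∈ E}

theorem mem_cay {E : Set V} {x y : V} : (x, y) ∈ cay E ↔ x - y ∈ E := Iff.rfl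

theorem cay_injective : Function.Injective (cay : Set V → Set (V × V)) := by
  intro C D h
  ext u
  have : (u, (0 : V)) ∈ cay C ↔ (u, (0 : V)) ∈ cay D := by rw [h]
  simpa [mem_cay] using this

theorem cay_zero : cay ({0} : Set V) = Set.diagonal V := by
  ext ⟨x, y⟩
  simp [mem_cay, sub_eq_zero]

theorem transpose_cay (E : Set V) : transpose (cay E) = cay (-E) := by
  ext ⟨x, y⟩
  simp [transpose, cay]

theorem hasIntersectionNumber_cay {C D E : Set V} {k : ℕ} :
    HasIntersectionNumber (cay C) (cay D) (cay E) k
      ↔ ∀ u ∈ E, {v | v ∈ C ∧ u - v ∈ D}.ncard = k := by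
  have key : ∀ x y : V, {z : V | (x, z) ∈ cay C ∧ (z, y) ∈ cay D}.ncard
      = {v | v ∈ C ∧ (x - y) - v ∈ D}.ncard := by
    intro x y
    rw [← Set.ncard_image_of_injective _ (sub_right_injective (b := x))]
    congr 1
    ext z
    simp only [mem_cay, Set.mem_image, Set.mem_ofPred_eq]
    constructor
    · rintro ⟨v, ⟨h1, h2⟩, rfl⟩
      exact ⟨h1, by convert h2 using 1; abel⟩
    · rintro ⟨h1, h2⟩
      exact ⟨x - z, ⟨by simpa using h1, by convert h2 using 1; abel⟩, by abel⟩
  constructor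
  · intro h u hu
    have := h u 0 (by simpa [mem_cay] using hu)
    rwa [key, sub_zero] at this
  · intro h x y hxy
    rw [key]
    exact h _ hxy

variable {F : V → W}

theorem rel_eq_cay (i : W) : rel F i = cay (fiberUnion F {i}) := by
  ext ⟨x, y⟩
  simp [rel, cay, fiberStar, fiberUnion, and_comm]

theorem mem_imageStar_iff {i : W} : i ∈ imageStar F ↔ (fiberUnion F {i}).Nonempty := Iff.rfl

theorem rel_injOn : Set.InjOn (rel F) (imageStar F) := by
  rintro i ⟨x, hx, rfl⟩ j _ h
  rw [rel_eq_cay, rel_eq_cay] at h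
  have h1 : x ∈ fiberUnion F {j} := by
    rw [← cay_injective h]
    exact ⟨hx, rfl⟩
  exact h1.2

theorem diagonal_ne_rel {i : W} : Set.diagonal V ≠ rel F i := by
  rw [rel_eq_cay, ← cay_zero]
  intro h
  have h1 : (0 : V) ∈ fiberUnion F {i} := by
    rw [← cay_injective h]
    rfl
  exact h1.1 rfl

theorem ncard_relations (hI : (imageStar F).Finite) :
    (relations F).ncard = (imageStar F).ncard + 1 := by
  rw [relations, Set.ncard_insert_of_notMem _ (hI.image _), rel_injOn.ncard_image]
  rintro ⟨i, _, h⟩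
  exact diagonal_ne_rel h.symm

theorem isFusion_relations : IsFusion (relations F) (relations F) where
  isPartition := by
    constructor
    · rintro (h | ⟨i, ⟨x, hx, rfl⟩, h⟩)
      · have : ((0 : V), (0 : V)) ∈ (∅ : Set (V × V)) := by
          rw [h]
          simp
        exact this
      · have : (x, (0 : V)) ∈ (∅ : Set (V × V)) := by
          rw [← h, rel_eq_cay, mem_cay, sub_zero]
          exact ⟨hx, rfl⟩
        exact this
    · rintro ⟨x, y⟩
      by_cases hxy : x = y
      · refine ⟨Set.diagonal V, ⟨Set.mem_insert _ _, hxy⟩, ?_⟩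
        rintro R ⟨rfl | ⟨i, _, rfl⟩, hR⟩
        · rfl
        · rw [rel_eq_cay] at hR
          exact absurd (sub_eq_zero.2 hxy) hR.1
      · have hne : x - y ≠ 0 := sub_ne_zero.2 hxy
        refine ⟨rel F (F (x - y)), ⟨Or.inr ⟨_, ⟨_, hne, rfl⟩, rfl⟩, ?_⟩, ?_⟩
        · rw [rel_eq_cay]
          exact ⟨hne, rfl⟩
        · rintro R ⟨rfl | ⟨i, _, rfl⟩, hR⟩
          · exact absurd hR hxy
          · rw [rel_eq_cay] at hR
            rw [show F (x - y) = i from hR.2]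
  diagonal_mem := Set.mem_insert _ _
  eq_sUnion A hA hne := ⟨{A}, by simpa using ⟨hA, hne⟩, by simp⟩

theorem IsFusion.exists_fiberUnion {𝓐 : Set (Set (V × V))} (h : IsFusion (relations F) 𝓐)
    {A : Set (V × V)} (hA : A ∈ 𝓐) (hne : A ≠ Set.diagonal V) :
    ∃ J : Set W, A = cay (fiberUnion F J) := by
  obtain ⟨𝓢, h𝓢, rfl⟩ := h.eq_sUnion A hA hne
  refine ⟨{i | rel F i ∈ 𝓢}, ?_⟩
  ext ⟨x, y⟩
  constructor
  · rintro ⟨R, hR, hxy⟩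
    obtain ⟨rfl | ⟨i, _, rfl⟩, hd⟩ := h𝓢 hR
    · exact absurd rfl hd
    · rw [rel_eq_cay] at hxy
      refine ⟨hxy.1, ?_⟩
      rw [show F (x - y) = i from hxy.2]
      exact hR
  · rintro ⟨hne, hR⟩
    refine ⟨_, hR, ?_⟩
    rw [rel_eq_cay]
    exact ⟨hne, rfl⟩

/-- If `F` is even and the number of ways to write `u ≠ 0` as a sum of a vector over `J` and a
vector over `K` depends only on whether `F u` lies in `J` and in `K`, then every fusion of the
relations of `F` is an association scheme. -/
theorem IsFusion.isAssociationScheme {𝓐 : Set (Set (V × V))} (h : IsFusion (relations F) 𝓐)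
    (heven : ∀ x, F (-x) = F x)
    (hcount : ∀ (J K : Set W) (u u' : V), u ≠ 0 → u' ≠ 0 → (F u ∈ J ↔ F u' ∈ J) →
      (F u ∈ K ↔ F u' ∈ K) →
      {v | v ∈ fiberUnion F J ∧ u - v ∈ fiberUnion F K}.ncard
        = {v | v ∈ fiberUnion F J ∧ u' - v ∈ fiberUnion F K}.ncard) :
    IsAssociationScheme 𝓐 := by
  have hform : ∀ A ∈ 𝓐, A = cay {0} ∨ ∃ J : Set W, A = cay (fiberUnion F J) := by
    intro A hA
    rw [cay_zero]
    by_cases hne : A = Set.diagonal V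
    · exact Or.inl hne
    · exact Or.inr (h.exists_fiberUnion hA hne)
  have hpart : ∀ C E : Set V, cay C ∈ 𝓐 → cay E ∈ 𝓐 → ∀ u ∈ E, ∀ u' ∈ E, u ∈ C → u' ∈ C := by
    intro C E hC hE u hu u' hu' huC
    have h1 := (h.isPartition.2 (u, 0)).unique (y₁ := cay C) (y₂ := cay E)
      ⟨hC, by simpa [mem_cay] using huC⟩ ⟨hE, by simpa [mem_cay] using hu⟩
    rw [cay_injective h1]
    exact hu'
  have hpart' : ∀ C E : Set V, cay C ∈ 𝓐 → cay E ∈ 𝓐 → ∀ u ∈ E, ∀ u' ∈ E, (u ∈ C ↔ u' ∈ C) :=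
    fun C E hC hE u hu u' hu' => ⟨hpart C E hC hE u hu u' hu', hpart C E hC hE u' hu' u hu⟩
  refine ⟨h.diagonal_mem, h.isPartition, ?_, ?_⟩
  · intro R hR
    obtain rfl | ⟨J, rfl⟩ := hform R hR
    · rw [transpose_cay]
      simpa using hR
    · rw [transpose_cay]
      convert hR using 2
      ext x
      simp [fiberUnion, heven]
  · intro R hR S hS T hT
    suffices hsuff : ∀ C D E : Set V, cay C ∈ 𝓐 → cay D ∈ 𝓐 → cay E ∈ 𝓐 →
        (C = {0} ∨ ∃ J : Set W, C = fiberUnion F J) → (D = {0} ∨ ∃ J : Set W, D = fiberUnion F J) →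
        (E = {0} ∨ ∃ J : Set W, E = fiberUnion F J) → ∀ u ∈ E, ∀ u' ∈ E,
        {v | v ∈ C ∧ u - v ∈ D}.ncard = {v | v ∈ C ∧ u' - v ∈ D}.ncard by
      have hform' : ∀ A ∈ 𝓐, ∃ E : Set V,
          A = cay E ∧ (E = {0} ∨ ∃ J : Set W, E = fiberUnion F J) := by
        intro A hA
        obtain rfl | ⟨J, rfl⟩ := hform A hA
        · exact ⟨_, rfl, Or.inl rfl⟩
        · exact ⟨_, rfl, Or.inr ⟨J, rfl⟩⟩
      obtain ⟨C, rfl, hC⟩ := hform' R hR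
      obtain ⟨D, rfl, hD⟩ := hform' S hS
      obtain ⟨E, rfl, hE⟩ := hform' T hT
      rcases E.eq_empty_or_nonempty with h0 | ⟨u, hu⟩
      · exact ⟨0, hasIntersectionNumber_cay.2 (by simp [h0])⟩
      · exact ⟨_, hasIntersectionNumber_cay.2 fun u' hu' =>
          hsuff C D E hR hS hT hC hD hE u' hu' u hu⟩
    intro C D E hC hD hE hC' hD' hE' u hu u' hu'
    rcases hC' with rfl | ⟨J, rfl⟩
    · have h1 : ∀ w : V, {v | v ∈ ({0} : Set V) ∧ w - v ∈ D} = {v | v = 0 ∧ w ∈ D} := by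
        intro w
        ext v
        simp +contextual
      simp only [h1, hpart' D E hD hE u hu u' hu']
    rcases hD' with rfl | ⟨K, rfl⟩
    · have h1 : ∀ w : V, {v | v ∈ fiberUnion F J ∧ w - v ∈ ({0} : Set V)}.ncard
          = {v : V | v = 0 ∧ w ∈ fiberUnion F J}.ncard := by
        intro w
        rw [← Set.ncard_image_of_injective _ (sub_right_injective (b := w))]
        congr 1
        ext v
        simp only [Set.mem_image, Set.mem_ofPred_eq, Set.mem_singleton_iff]
        constructor
        · rintro ⟨v, ⟨h1, h2⟩, rfl⟩
          rw [h2, sub_eq_zero.1 h2]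
          exact ⟨rfl, h1⟩
        · rintro ⟨rfl, h2⟩
          exact ⟨w, ⟨h2, sub_self w⟩, sub_self w⟩
      rw [h1, h1]
      simp only [hpart' _ E hC hE u hu u' hu']
    rcases hE' with rfl | ⟨L, rfl⟩
    · rw [Set.mem_singleton_iff.1 hu, Set.mem_singleton_iff.1 hu']
    · have e := fun M hM => hpart' (fiberUnion F M) _ hM hE u hu u' hu'
      simp only [fiberUnion, Set.mem_ofPred_eq, hu.1, hu'.1, ne_eq, not_false_eq_true,
        true_and] at e
      exact hcount J K u u' hu.1 hu'.1 (e J hC) (e K hD)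

end CayleyRelations

/-! ### From dual pairs to amorphic schemes -/

section Counting

variable {p : ℕ} [Fact p.Prime]
variable {V W : Type*} [AddCommGroup V] [Fintype V] {F : V → W}

theorem sum_ncard_fiberUnion [Fintype W] (F : V → W) :
    ∑ i, (fiberUnion F {i}).ncard = Fintype.card V - 1 := by
  classical
  have h1 : ∀ i, (fiberUnion F {i}).ncard
      = ((Finset.univ.erase 0).filter (fun x => F x = i)).card := by
    intro i
    rw [← Set.ncard_coe_finset]
    congr 1
    ext x
    simp [fiberUnion]
  simp only [h1]
  rw [← Finset.card_eq_sum_card_fiberwise (fun x _ => Finset.mem_coe.2 (Finset.mem_univ (F x))),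
    Finset.card_erase_of_mem (Finset.mem_univ _), Finset.card_univ]

theorem ncard_preimage_singleton [DecidableEq W] (i : W) :
    (F ⁻¹' {i}).ncard = (fiberUnion F {i}).ncard + if F 0 = i then 1 else 0 := by
  split_ifs with h
  · rw [← Set.ncard_insert_of_notMem (a := (0 : V)) (fun h => h.1 rfl)]
    congr 1
    ext x
    by_cases hx : x = 0 <;> simp [fiberUnion, hx, h]
  · rw [add_zero]
    congr 1
    ext x
    by_cases hx : x = 0 <;> simp [fiberUnion, hx, h]

omit [Fintype V] in
/-- For an even function, the valency of `R_i` is the intersection number of `R_i` with itself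
relative to the identity relation. -/
theorem hasIntersectionNumber_diagonal (heven : ∀ x, F (-x) = F x) {i : W} {k : ℕ} :
    HasIntersectionNumber (rel F i) (rel F i) (Set.diagonal V) k
      ↔ (fiberUnion F {i}).ncard = k := by
  rw [rel_eq_cay, ← cay_zero, hasIntersectionNumber_cay]
  have : {v | v ∈ fiberUnion F {i} ∧ 0 - v ∈ fiberUnion F {i}} = fiberUnion F {i} := by
    ext x
    simp +contextual [fiberUnion, heven]
  simp only [Set.mem_singleton_iff, forall_eq, this]

/-- Counting the nonzero vectors fiber by fiber determines the image of `F`, if the nonempty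
fibers have the prescribed sizes. -/
theorem imageStar_of_valencies {n m : ℕ} (hn : 4 ≤ n) (hn_even : Even n) (hm : 2 ≤ m)
    (hmn : m ≤ n / 2) (hV : Fintype.card V = p ^ n) [Fintype W] (hW : Fintype.card W = p ^ m)
    {ε : ℤ} (hε : ε = 1 ∨ ε = -1) (hε3 : p ≠ 3 → ε = 1)
    (hval : ∀ i ∈ imageStar F, ((fiberUnion F {i}).ncard : ℤ)
      = (p : ℤ) ^ (n - m) - ε * (p : ℤ) ^ (n / 2 - m)
        + Set.indicator {F 0} 1 i * (ε * (p : ℤ) ^ (n / 2) - 1)) :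
    (¬ (p = 3 ∧ n = 2 * m ∧ ε = -1) →
      imageStar F = Set.univ ∧ (imageStar F).ncard = p ^ m) ∧
    (p = 3 ∧ n = 2 * m ∧ ε = -1 →
      imageStar F = {F 0}ᶜ ∧ (imageStar F).ncard = 3 ^ m - 1) := by
  classical
  have hp : 2 ≤ p := (Fact.out : p.Prime).two_le
  obtain ⟨h, rfl⟩ := hn_even.exists_two_nsmul
  simp only [smul_eq_mul] at *
  rw [Nat.mul_div_cancel_left _ (by norm_num)] at *
  obtain ⟨e, rfl⟩ := Nat.exists_eq_add_of_le hmn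
  rw [show 2 * (m + e) - m = e + (m + e) by omega, Nat.add_sub_cancel_left] at hval
  set r : ℤ := (p : ℤ) ^ e with hr
  set M : ℤ := (p : ℤ) ^ m with hM
  have hq : (p : ℤ) ^ (m + e) = M * r := pow_add _ _ _
  have hrq : (p : ℤ) ^ (e + (m + e)) = r * (M * r) := by rw [pow_add, hq]
  have hr0 : 0 < r := by positivity
  have hM4 : 4 ≤ M := by
    calc (4 : ℤ) = 2 ^ 2 := by norm_num
      _ ≤ (p : ℤ) ^ 2 := by gcongr; exact_mod_cast hp
      _ ≤ M := pow_le_pow_right₀ (by exact_mod_cast (by omega : 1 ≤ p)) hm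
  have hq4 : 4 ≤ M * r := by nlinarith
  rw [hrq, hq] at hval
  have hε2 : ε * ε = 1 := by rcases hε with rfl | rfl <;> norm_num
  have hqε : M * r - ε ≠ 0 := by rcases hε with rfl | rfl <;> linarith
  set I : Finset W := Finset.univ.filter (· ∈ imageStar F) with hI
  have hIc : (I : Set W) = imageStar F := by simp [hI]
  have hIn : (imageStar F).ncard = I.card := by rw [← hIc, Set.ncard_coe_finset]
  have hsum : ∑ i ∈ I, ((fiberUnion F {i}).ncard : ℤ) = (M * r) ^ 2 - 1 := by
    have h1 := sum_ncard_fiberUnion F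
    rw [hV] at h1
    have h2 : ∑ i ∈ I, (fiberUnion F {i}).ncard = ∑ i, (fiberUnion F {i}).ncard := by
      refine Finset.sum_subset (Finset.subset_univ _) fun i _ hi => ?_
      rw [Set.ncard_eq_zero, ← Set.not_nonempty_iff_eq_empty]
      simpa [hI, mem_imageStar_iff] using hi
    rw [← Nat.cast_sum, h2, h1, Nat.cast_sub (Nat.one_le_pow _ _ (by omega))]
    push_cast
    rw [← hq]
    ring
  rw [Finset.sum_congr rfl fun i hi => hval i (by simpa [hI] using hi), Finset.sum_add_distrib,
    Finset.sum_const, ← Finset.sum_mul, nsmul_eq_mul] at hsum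
  have hind : ∑ i ∈ I, Set.indicator {F 0} (1 : W → ℤ) i = if F 0 ∈ imageStar F then 1 else 0 := by
    simp [Set.indicator_apply, hI]
  rw [hind] at hsum
  -- Both sides of the count are divisible by `q - ε`, where `q = M * r`.
  have hcard : (I.card : ℤ) * r + (if F 0 ∈ imageStar F then 1 else 0) * ε = M * r + ε := by
    apply mul_left_cancel₀ hqε
    linear_combination hsum + (1 - if F 0 ∈ imageStar F then 1 else 0) * hε2
  -- In the exceptional case the prescribed size of the fiber over `F 0` is zero.
  have hF0 : p = 3 ∧ 2 * (m + e) = 2 * m ∧ ε = -1 → F 0 ∉ imageStar F := by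
    rintro ⟨_, h2, rfl⟩ h3
    have he : e = 0 := by omega
    have h4 := hval _ h3
    simp only [hr, he, Set.mem_singleton_iff, Set.indicator_of_mem, Pi.one_apply] at h4
    have h5 : (fiberUnion F {F 0}).ncard = 0 := by
      zify
      rw [h4]
      ring
    rw [Set.ncard_eq_zero] at h5
    rw [mem_imageStar_iff, h5] at h3
    exact Set.not_nonempty_empty h3
  by_cases h0 : F 0 ∈ imageStar F
  · refine ⟨fun _ => ?_, fun h => absurd h0 (hF0 h)⟩
    simp only [h0, if_true, one_mul, add_left_inj] at hcard
    have h1 : I.card = p ^ m := by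
      have := mul_right_cancel₀ hr0.ne' hcard
      rw [hM] at this
      exact_mod_cast this
    have h2 : I = Finset.univ := by
      rw [← Finset.card_eq_iff_eq_univ, h1, hW]
    rw [hIn, h1, ← hIc, h2]
    simp
  · simp only [h0, if_false, zero_mul, add_zero] at hcard
    have h1 : r * ((I.card : ℤ) - M) = ε := by linear_combination hcard
    have hsub : I ⊆ Finset.univ.erase (F 0) := by
      intro i hi
      rw [Finset.mem_erase]
      refine ⟨?_, Finset.mem_univ _⟩
      rintro rfl
      exact h0 (by simpa [hI] using hi)
    have hcc : (Finset.univ.erase (F 0)).card = p ^ m - 1 := by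
      rw [Finset.card_erase_of_mem (Finset.mem_univ _), Finset.card_univ, hW]
    have h1p : 1 ≤ p ^ m := Nat.one_le_pow _ _ (by omega)
    have h2 : (I.card : ℤ) ≤ M - 1 := by
      have := Finset.card_le_card hsub
      rw [hcc] at this
      zify [h1p] at this
      exact this
    have h3 : ε = -1 := by
      rcases hε with rfl | rfl
      · nlinarith
      · rfl
    have hr1 : r = 1 := by
      have h4 : r ∣ 1 := by
        rw [← hε2, ← h1, mul_assoc]
        exact dvd_mul_right _ _
      exact Int.eq_one_of_dvd_one hr0.le h4
    have he : e = 0 := by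
      by_contra he
      have : 1 < (p : ℤ) ^ e := one_lt_pow₀ (by exact_mod_cast hp) he
      rw [← hr, hr1] at this
      exact lt_irrefl _ this
    have hp3 : p = 3 := by
      by_contra h
      have := hε3 h
      omega
    refine ⟨fun h => absurd ⟨hp3, by omega, h3⟩ h, fun _ => ?_⟩
    rw [hr1, h3, one_mul] at h1
    have h5 : I.card = p ^ m - 1 := by
      zify [h1p]
      rw [← hM]
      linarith
    have h6 : I = Finset.univ.erase (F 0) := Finset.eq_of_subset_of_card_le hsub (by rw [h5, hcc])
    rw [hIn, h5, ← hIc, h6, hp3]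
    refine ⟨?_, rfl⟩
    ext x
    simp

end Counting

section Direct

variable {p : ℕ} [Fact p.Prime]
variable {V : Type*} [AddCommGroup V] [Module (ZMod p) V] [Fintype V]
variable {W : Type*} [Fintype W] [Nonempty W]
variable {B : LinearMap.BilinForm (ZMod p) V} {F G : V → W}

/-- The first half of a dual pair defines an amorphic scheme with the prescribed valencies. -/
theorem IsDualPair.isPrescribedScheme {n m : ℕ} (hn : 4 ≤ n) (hn_even : Even n) (hm : 2 ≤ m)
    (hmn : m ≤ n / 2) (hV : Fintype.card V = p ^ n) (hW : Fintype.card W = p ^ m)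
    (hB : B.Nondegenerate) (hs : B.IsSymm) {ε : ℤ} (hε : ε = 1 ∨ ε = -1) (hε2 : p = 2 → ε = 1)
    (H : IsDualPair B F G (ε * (p : ℝ) ^ (n / 2))) : IsPrescribedScheme p n m F ε := by
  classical
  have hp : 2 ≤ p := (Fact.out : p.Prime).two_le
  have hnn : n = n / 2 + n / 2 := by obtain ⟨h, rfl⟩ := hn_even; omega
  have heven := H.map_neg hB
  have hκ : (ε * (p : ℝ) ^ (n / 2)) ^ 2 = Fintype.card V := by
    have h1 : ((ε : ℝ)) ^ 2 = 1 := by rcases hε with rfl | rfl <;> norm_num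
    rw [hV, mul_pow, h1, one_mul, pow_two, ← pow_add, ← hnn]
    norm_cast
  have hM : 4 ≤ Fintype.card W := by
    rw [hW]
    calc 4 = 2 ^ 2 := by norm_num
      _ ≤ p ^ 2 := by gcongr
      _ ≤ p ^ m := pow_le_pow_right₀ (by omega) hm
  have h0 : G 0 = F 0 := H.map_zero hB hs hκ (by omega)
  have hM0 : (p : ℂ) ^ m ≠ 0 := by
    have : p ≠ 0 := by omega
    positivity
  have hval : ∀ i, ((fiberUnion F {i}).ncard : ℤ)
      = (p : ℤ) ^ (n - m) - ε * (p : ℤ) ^ (n / 2 - m)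
        + Set.indicator {F 0} 1 i * (ε * (p : ℤ) ^ (n / 2) - 1) := by
    intro i
    have h1 := H.ncard_fiber i
    rw [ncard_preimage_singleton, h0, hV, hW] at h1
    have e1 : (p : ℂ) ^ n = p ^ m * p ^ (n - m) := by rw [← pow_add]; congr 1; omega
    have e2 : (p : ℂ) ^ (n / 2) = p ^ m * p ^ (n / 2 - m) := by rw [← pow_add]; congr 1; omega
    have e3 : ((p ^ n : ℕ) - ((ε * (p : ℝ) ^ (n / 2) : ℝ) : ℂ)) / (p ^ m : ℕ)
        = (p : ℂ) ^ (n - m) - ε * p ^ (n / 2 - m) := by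
      rw [div_eq_iff (by exact_mod_cast hM0)]
      push_cast
      rw [e1, e2]
      ring
    rw [e3] at h1
    have h2 : ((fiberUnion F {i}).ncard : ℂ) = (p : ℂ) ^ (n - m) - ε * p ^ (n / 2 - m)
        + (if F 0 = i then 1 else 0) * (ε * p ^ (n / 2) - 1) := by
      push_cast [ind_apply] at h1
      by_cases hi : F 0 = i <;> simp [hi] at h1 ⊢ <;> linear_combination h1
    have h3 : Set.indicator {F 0} (1 : W → ℤ) i = if F 0 = i then 1 else 0 := by
      simp [Set.indicator_apply, eq_comm]
    rw [h3]
    by_cases hi : F 0 = i <;> simp only [hi, if_true, if_false] at h2 ⊢ <;> exact_mod_cast h2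
  -- For `p > 3`, the fibers are stable under scalars, so that `p - 1` divides their sizes.
  have hε3 : p ≠ 3 → ε = 1 := by
    intro hp3
    by_contra hne
    have hε1 : ε = -1 := hε.resolve_left hne
    have hp2 : p ≠ 2 := fun h => hne (hε2 h)
    obtain ⟨i, hi⟩ := Fintype.exists_ne_of_one_lt_card (by omega : 1 < Fintype.card W) (F 0)
    have hdvd : p - 1 ∣ (fiberUnion F {i}).ncard := by
      refine sub_one_dvd_ncard (fun h => h.1 rfl) fun t ht x => ?_
      refine smul_mem_iff_of_fourier_int hB (fun a => ?_) ht x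
      have e : ind (fiberUnion F {i})
          = (bal {i} ∘ F) + ((1 : ℂ) / Fintype.card W) • (1 : V → ℂ) := by
        funext x
        rw [ind_fiberUnion]
        simp [ind_apply, hi.symm]
      have e2 : (p : ℂ) ^ (n / 2) = p ^ m * p ^ (n / 2 - m) := by rw [← pow_add]; congr 1; omega
      have e1 : (p : ℂ) ^ n = p ^ m * p ^ (n - m) := by rw [← pow_add]; congr 1; omega
      refine ⟨-((p : ℤ) ^ (n / 2) * (if G a = i then 1 else 0) - p ^ (n / 2 - m))
        + (if a = 0 then (p : ℤ) ^ (n - m) else 0), ?_⟩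
      rw [e, map_add, map_smul, Pi.add_apply, Pi.smul_apply, H _ (sum_bal _), fourier_one hB hs,
        hV, hW]
      simp only [bal, ind_apply, hW, hε1, Set.ncard_singleton, Set.mem_singleton_iff]
      push_cast
      rw [e1, e2]
      split_ifs <;> simp only [smul_eq_mul] <;> field_simp <;> ring
    have h1 : ((p - 1 : ℕ) : ℤ) ∣ (p : ℤ) ^ (n - m) + p ^ (n / 2 - m) := by
      have h2 := hval i
      have h3 : Set.indicator {F 0} (1 : W → ℤ) i = 0 := by simp [hi]
      rw [h3, hε1] at h2
      have h4 : (p : ℤ) ^ (n - m) + p ^ (n / 2 - m) = ((fiberUnion F {i}).ncard : ℤ) := by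
        rw [h2]
        ring
      rw [h4]
      exact_mod_cast hdvd
    rw [Nat.cast_sub (by omega), Nat.cast_one] at h1
    have h2 : ((p : ℤ) - 1) ∣ 2 := by
      have h3 : ∀ k : ℕ, ((p : ℤ) - 1) ∣ p ^ k - 1 := fun k => by
        simpa using sub_dvd_pow_sub_pow (p : ℤ) 1 k
      have h4 := (h1.sub (h3 (n - m))).sub (h3 (n / 2 - m))
      have h6 : (p : ℤ) ^ (n - m) + p ^ (n / 2 - m) - (p ^ (n - m) - 1) - (p ^ (n / 2 - m) - 1)
          = 2 := by ring
      rwa [h6] at h4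
    have h5 := Int.le_of_dvd (by norm_num) h2
    omega
  obtain ⟨hI1, hI2⟩ := imageStar_of_valencies hn hn_even hm hmn hV hW hε hε3 (fun i _ => hval i)
  have hfusion : ∀ 𝓐, IsFusion (relations F) 𝓐 → IsAssociationScheme 𝓐 := fun 𝓐 h =>
    h.isAssociationScheme heven fun J K u u' hu hu' hJ hK => H.ncard_eq hB hκ J K hu hu' hJ hK
  refine ⟨⟨hfusion _ isFusion_relations, Set.toFinite _, ncard_relations (Set.toFinite _),
    hfusion⟩, ?_, hε, hε3, fun i _ => ⟨_, (hasIntersectionNumber_diagonal heven).2 rfl, hval i⟩⟩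
  by_cases hex : p = 3 ∧ n = 2 * m ∧ ε = -1
  · have h1 := (hI2 hex).2
    rw [hex.1] at hW
    omega
  · have h1 := (hI1 hex).2
    omega

end Direct

/-! ### Families of two-valued functions -/

section TwoValued

theorem root_of_quadratic {b c x y z : ℝ} (hx : x ^ 2 + b * x + c = 0) (hy : y ^ 2 + b * y + c = 0)
    (hz : z ^ 2 + b * z + c = 0) (hxy : x ≠ y) : z = x ∨ z = y := by
  have h1 : x + y + b = 0 := by
    apply mul_left_cancel₀ (sub_ne_zero.2 hxy)
    linear_combination hx - hy
  have h2 : (z - x) * (z - y) = 0 := by linear_combination hz - hx + (x - z) * h1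
  rcases mul_eq_zero.1 h2 with h | h
  · exact Or.inl (sub_eq_zero.1 h)
  · exact Or.inr (sub_eq_zero.1 h)

variable {A ι : Type*} {θ : ι → A → ℝ}

/-- Two-valued functions with constant sum whose two values differ by the same amount for all of
them, and no two of which take their second value at the same point, are the indicator functions
of a partition, up to scaling and shifts. -/
theorem exists_eq_add_ite_of_disjoint [Fintype ι] [DecidableEq ι] {s r : ι → ℝ} {D C : ℝ}
    (hD : D ≠ 0) (hr : ∀ i, r i = s i + D) (hθ : ∀ i a, θ i a = s i ∨ θ i a = r i)
    (hdisj : ∀ i j, i ≠ j → ∀ a, ¬ (θ i a = r i ∧ θ j a = r j))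
    (hsum : ∀ a, ∑ i, θ i a = C) (hex : ∃ i a, θ i a = r i) :
    ∃ (D : ℝ) (t : ι → ℝ) (G : A → ι), D ≠ 0 ∧
      ∀ i a, θ i a = t i + D * if G a = i then 1 else 0 := by
  have key : ∀ i a, θ i a = r i → ∀ j, θ j a = s j + D * if i = j then 1 else 0 := by
    intro i a h j
    by_cases hij : i = j
    · subst hij
      simp [h, hr]
    · simp only [hij, if_false, mul_zero, add_zero]
      exact (hθ j a).resolve_right fun h' => hdisj i j hij a ⟨h, h'⟩
  have hC : C = ∑ i, s i + D := by
    obtain ⟨i, a, h⟩ := hex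
    rw [← hsum a, Finset.sum_congr rfl fun j _ => key i a h j]
    simp [Finset.sum_add_distrib]
  have hG : ∀ a, ∃ i, θ i a = r i := by
    intro a
    by_contra! h
    have h1 := hsum a
    rw [Finset.sum_congr rfl fun j _ => (hθ j a).resolve_right (h j), hC] at h1
    exact hD (by linarith)
  choose G hG using hG
  exact ⟨D, s, G, hD, fun i a => key _ a (hG a) i⟩

/-- Two two-valued functions that are linearly independent modulo constants, and whose sum takes
at most two values: the pair of the larger or the pair of the smaller values does not occur, the
mixed pairs do, and the differences of the two values agree. -/
theorem two_valued_pair {f g : A → ℝ} {s r s' r' : ℝ} (hsr : s < r) (hsr' : s' < r')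
    (hf : ∀ a, f a = s ∨ f a = r) (hg : ∀ a, g a = s' ∨ g a = r')
    (hfg : ∃ b c, ∀ a, (f a + g a) ^ 2 + b * (f a + g a) + c = 0)
    (hind : ∀ α β γ : ℝ, (∀ a, α + β * f a + γ * g a = 0) → β = 0 ∧ γ = 0) :
    ((∀ a, ¬ (f a = r ∧ g a = r')) ∨ (∀ a, ¬ (f a = s ∧ g a = s'))) ∧
      r - s = r' - s' ∧ (∃ a, f a = r ∧ g a = s') := by
  obtain ⟨b, c, hq⟩ := hfg
  have h3 : ∀ {x y z : A}, f x + g x ≠ f y + g y →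
      f z + g z = f x + g x ∨ f z + g z = f y + g y :=
    fun hxy => root_of_quadratic (hq _) (hq _) (hq _) hxy
  have hmiss : (∀ a, ¬ (f a = r ∧ g a = r')) ∨ (∀ a, ¬ (f a = s ∧ g a = s')) := by
    by_contra! h
    obtain ⟨⟨x, hx, hx'⟩, ⟨y, hy, hy'⟩⟩ := h
    have hxy : f x + g x ≠ f y + g y := by
      rw [hx, hx', hy, hy']
      intro h
      linarith
    have := (hind (s * (r' - s') - s' * (r - s)) (-(r' - s')) (r - s) fun a => by
      have := h3 (z := a) hxy
      rw [hx, hx', hy, hy'] at this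
      rcases hf a with h | h <;> rcases hg a with h' | h' <;> rw [h, h'] at this ⊢
      · ring
      · exfalso
        rcases this with h | h <;> linarith
      · exfalso
        rcases this with h | h <;> linarith
      · ring).2
    linarith
  have hrs : ∃ a, f a = r ∧ g a = s' := by
    by_contra! hne
    rcases hmiss with h | h
    · have := (hind (-s) 1 0 fun a => by
        rcases hf a with h1 | h1
        · rw [h1]
          ring
        · rcases hg a with h2 | h2
          · exact absurd h2 (hne a h1)
          · exact absurd ⟨h1, h2⟩ (h a)).1
      norm_num at this
    · have := (hind (-r') 0 1 fun a => by
        rcases hg a with h2 | h2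
        · rcases hf a with h1 | h1
          · exact absurd ⟨h1, h2⟩ (h a)
          · exact absurd h2 (hne a h1)
        · rw [h2]
          ring).2
      norm_num at this
  have hsr'' : ∃ a, f a = s ∧ g a = r' := by
    by_contra! hne
    rcases hmiss with h | h
    · have := (hind (-s') 0 1 fun a => by
        rcases hg a with h2 | h2
        · rw [h2]
          ring
        · rcases hf a with h1 | h1
          · exact absurd h2 (hne a h1)
          · exact absurd ⟨h1, h2⟩ (h a)).2
      norm_num at this
    · have := (hind (-r) 1 0 fun a => by
        rcases hf a with h1 | h1
        · rcases hg a with h2 | h2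
          · exact absurd ⟨h1, h2⟩ (h a)
          · exact absurd h2 (hne a h1)
        · rw [h1]
          ring).1
      norm_num at this
  refine ⟨hmiss, ?_, hrs⟩
  by_contra hD
  obtain ⟨x, hx, hx'⟩ := hrs
  obtain ⟨y, hy, hy'⟩ := hsr''
  have hxy : f x + g x ≠ f y + g y := by
    rw [hx, hx', hy, hy']
    intro h
    exact hD (by linarith)
  have := (hind (-(r * (r' - s')) - s' * (r - s)) (r' - s') (r - s) fun a => by
    have := h3 (z := a) hxy
    rw [hx, hx', hy, hy'] at this
    rcases hf a with h | h <;> rcases hg a with h' | h' <;> rw [h, h'] at this ⊢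
    · exfalso
      rcases this with h | h <;> linarith
    · ring
    · ring
    · exfalso
      rcases this with h | h <;> linarith).2
  linarith

/-- Real functions with constant sum such that each function and each sum of two functions takes
at most two values, and any two functions are linearly independent modulo constants: up to scaling
and shifts, they are the indicator functions of a partition. -/
theorem exists_eq_add_ite [Fintype ι] [DecidableEq ι] [Nontrivial ι] {C : ℝ}
    (h1 : ∀ i, ∃ b c, ∀ a, θ i a ^ 2 + b * θ i a + c = 0)
    (h2 : ∀ i j, i ≠ j → ∃ b c, ∀ a, (θ i a + θ j a) ^ 2 + b * (θ i a + θ j a) + c = 0)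
    (hind : ∀ i j, i ≠ j → ∀ α β γ : ℝ, (∀ a, α + β * θ i a + γ * θ j a = 0) → β = 0 ∧ γ = 0)
    (hsum : ∀ a, ∑ i, θ i a = C) :
    ∃ (D : ℝ) (t : ι → ℝ) (G : A → ι), D ≠ 0 ∧
      ∀ i a, θ i a = t i + D * if G a = i then 1 else 0 := by
  have hval : ∀ i, ∃ s r : ℝ, s < r ∧ ∀ a, θ i a = s ∨ θ i a = r := by
    intro i
    obtain ⟨j, hj⟩ := exists_ne i
    obtain ⟨b, c, hbc⟩ := h1 i
    have hnc : ∃ x y, θ i x < θ i y := by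
      by_contra! h
      rcases isEmpty_or_nonempty A with hA | ⟨⟨x⟩⟩
      · have := (hind i j hj.symm 0 1 0 fun a => hA.elim a).1
        norm_num at this
      · have := (hind i j hj.symm (-θ i x) 1 0 fun a => by
          have := le_antisymm (h a x) (h x a)
          linarith).1
        norm_num at this
    obtain ⟨x, y, hxy⟩ := hnc
    exact ⟨_, _, hxy, fun a => root_of_quadratic (hbc x) (hbc y) (hbc a) hxy.ne⟩
  choose s r hsr hθ using hval
  have hpair := fun i j hij =>
    two_valued_pair (hsr i) (hsr j) (hθ i) (hθ j) (h2 i j hij) (hind i j hij)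
  obtain ⟨i₀, j₀, hij₀⟩ := exists_pair_ne ι
  have hD : ∀ i, r i - s i = r i₀ - s i₀ := by
    intro i
    by_cases h : i = i₀
    · rw [h]
    · exact (hpair i i₀ h).2.1
  -- The missing pair of values is of the same kind for any two pairs of functions.
  have hstep : ∀ i j, i ≠ j → (∀ a, ¬ (θ i a = r i ∧ θ j a = r j)) →
      ∀ k, k ≠ i → ∀ a, ¬ (θ i a = r i ∧ θ k a = r k) := by
    intro i j hij hN k hk
    by_cases hkj : k = j
    · rwa [hkj]
    · refine (hpair i k hk.symm).1.resolve_right fun hS => ?_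
      obtain ⟨a, ha, ha'⟩ := (hpair j k (Ne.symm hkj)).2.2
      rcases hθ i a with h | h
      · exact hS a ⟨h, ha'⟩
      · exact hN a ⟨h, ha⟩
  by_cases hN : ∃ i j, i ≠ j ∧ ∀ a, ¬ (θ i a = r i ∧ θ j a = r j)
  · obtain ⟨i, j, hij, hN⟩ := hN
    refine exists_eq_add_ite_of_disjoint (D := r i₀ - s i₀) (sub_ne_zero.2 (hsr i₀).ne')
      (fun k => by linarith [hD k]) hθ ?_ hsum ?_
    · intro k l hkl
      by_cases hki : k = i
      · rw [hki] at hkl ⊢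
        exact hstep i j hij hN l hkl.symm
      · exact hstep k i hki (fun a ha => hstep i j hij hN k hki a ha.symm) l hkl.symm
    · obtain ⟨a, ha, _⟩ := (hpair _ _ hij₀).2.2
      exact ⟨i₀, a, ha⟩
  · push Not at hN
    refine exists_eq_add_ite_of_disjoint (s := r) (r := s) (D := s i₀ - r i₀)
      (sub_ne_zero.2 (hsr i₀).ne) (fun k => by linarith [hD k]) (fun i a => (hθ i a).symm)
      ?_ hsum ?_
    · intro k l hkl
      refine (hpair k l hkl).1.resolve_left fun h => ?_
      obtain ⟨a, ha⟩ := hN k l hkl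
      exact h a ha
    · obtain ⟨a, _, ha⟩ := (hpair _ _ hij₀).2.2
      exact ⟨j₀, a, ha⟩

end TwoValued

/-! ### Symmetry and eigenvalues of amorphic schemes -/

section AmorphicSchemes

variable {V W : Type*} [AddCommGroup V] {F : V → W}

/-- Merging the non-identity relations into two classes is a fusion. -/
theorem isFusion_pair {J : Set W} (hJ : (fiberUnion F J).Nonempty)
    (hJc : (fiberUnion F Jᶜ).Nonempty) :
    IsFusion (relations F) {Set.diagonal V, cay (fiberUnion F J), cay (fiberUnion F Jᶜ)} := by
  have hunion : ∀ K : Set W, ∃ 𝓢 ⊆ relations F \ {Set.diagonal V},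
      cay (fiberUnion F K) = ⋃₀ 𝓢 := by
    intro K
    refine ⟨rel F '' (imageStar F ∩ K), ?_, ?_⟩
    · rintro _ ⟨i, hi, rfl⟩
      exact ⟨Or.inr ⟨i, hi.1, rfl⟩, fun h => diagonal_ne_rel (Set.mem_singleton_iff.1 h).symm⟩
    · ext ⟨x, y⟩
      simp only [Set.sUnion_image, Set.mem_iUnion, rel_eq_cay, mem_cay]
      constructor
      · rintro ⟨h1, h2⟩
        exact ⟨F (x - y), ⟨⟨_, h1, rfl⟩, h2⟩, h1, rfl⟩
      · rintro ⟨i, ⟨_, hi⟩, h1, h2⟩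
        exact ⟨h1, by rwa [show F (x - y) = i from h2]⟩
  have hne : ∀ K : Set W, (fiberUnion F K).Nonempty → cay (fiberUnion F K) ≠ ∅ := by
    rintro K ⟨x, hx⟩ h
    have : (x, (0 : V)) ∈ cay (fiberUnion F K) := by
      rw [mem_cay, sub_zero]
      exact hx
    rw [h] at this
    exact this
  refine ⟨⟨?_, ?_⟩, Set.mem_insert _ _, ?_⟩
  · rintro (h | h | h)
    · have : ((0 : V), (0 : V)) ∈ (∅ : Set (V × V)) := by
        rw [h]
        simp
      exact this
    · exact hne J hJ h.symm
    · exact hne Jᶜ hJc h.symm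
  · rintro ⟨x, y⟩
    rw [← cay_zero]
    by_cases h0 : x - y = 0
    · refine ⟨cay {0}, ⟨Or.inl rfl, h0⟩, ?_⟩
      rintro R ⟨rfl | rfl | rfl, hR⟩
      · rfl
      · exact absurd h0 hR.1
      · exact absurd h0 hR.1
    · by_cases hJ : F (x - y) ∈ J
      · refine ⟨cay (fiberUnion F J), ⟨Or.inr (Or.inl rfl), h0, hJ⟩, ?_⟩
        rintro R ⟨rfl | rfl | rfl, hR⟩
        · exact absurd hR h0
        · rfl
        · exact absurd hJ hR.2
      · refine ⟨cay (fiberUnion F Jᶜ), ⟨Or.inr (Or.inr rfl), h0, hJ⟩, ?_⟩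
        rintro R ⟨rfl | rfl | rfl, hR⟩
        · exact absurd hR h0
        · exact absurd hR.2 hJ
        · rfl
  · rintro A (rfl | rfl | rfl) hA
    · exact absurd rfl hA
    · exact hunion J
    · exact hunion Jᶜ

theorem fiberUnion_compl_nonempty {J : Set W} {i : W} (hi : i ∈ imageStar F) (hiJ : i ∉ J) :
    (fiberUnion F Jᶜ).Nonempty := by
  obtain ⟨x, hx, rfl⟩ := hi
  exact ⟨x, hx, hiJ⟩

/-- An amorphic scheme with at least three classes is symmetric: if transposition exchanged `R_i`
and `R_j`, merging `R_j` with a third relation would destroy closure under transposition. -/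
theorem IsAmorphicScheme.map_neg {d : ℕ} (h : IsAmorphicScheme d (relations F))
    (h3 : 3 ≤ (imageStar F).ncard) (x : V) : F (-x) = F x := by
  rcases eq_or_ne x 0 with rfl | hx
  · rw [neg_zero]
  by_contra hne
  have hfin : (imageStar F).Finite := Set.finite_of_ncard_pos (by omega)
  obtain ⟨k, hk, hk'⟩ : ∃ k ∈ imageStar F, k ∉ ({F x, F (-x)} : Set W) := by
    apply Set.exists_mem_notMem_of_ncard_lt_ncard _ (by simp)
    exact (Set.ncard_insert_le _ _).trans_lt (by rw [Set.ncard_singleton]; omega)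
  simp only [Set.mem_insert_iff, Set.mem_singleton_iff, not_or] at hk'
  have hi : F x ∈ imageStar F := ⟨x, hx, rfl⟩
  have hfus := h.fusion _ (isFusion_pair (J := {F x}) hi (fiberUnion_compl_nonempty hk hk'.1))
  have hneg : -x ≠ 0 := neg_ne_zero.2 hx
  have hx1 : -x ∈ -fiberUnion F {F x} := by
    rw [Set.mem_neg, neg_neg]
    exact ⟨hx, rfl⟩
  -- The transpose of `R_i` is the union of all other relations, by the two-class fusion.
  have hA : -fiberUnion F {F x} = fiberUnion F {F x}ᶜ := by
    have h1 := hfus.transpose_mem (cay (fiberUnion F {F x})) (Or.inr (Or.inl rfl))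
    rw [transpose_cay, ← cay_zero] at h1
    rcases h1 with h1 | h1 | h1
    · rw [cay_injective h1] at hx1
      exact absurd hx1 hneg
    · rw [cay_injective h1] at hx1
      exact absurd hx1.2 hne
    · exact cay_injective h1
  -- It is also a single relation.
  have h1 := h.isAssociationScheme.transpose_mem (rel F (F x)) (Or.inr ⟨_, hi, rfl⟩)
  rw [rel_eq_cay, transpose_cay, hA] at h1
  rw [hA] at hx1
  rcases h1 with h1 | ⟨j, _, h1⟩
  · rw [← cay_zero] at h1
    rw [cay_injective h1] at hx1
    exact hneg hx1
  · rw [rel_eq_cay] at h1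
    have h2 := cay_injective h1
    obtain ⟨y, hy, rfl⟩ := hk
    have hy1 : y ∈ fiberUnion F {F x}ᶜ := ⟨hy, hk'.1⟩
    rw [← h2] at hx1 hy1
    exact hk'.2 (hy1.2.trans hx1.2.symm)

end AmorphicSchemes

section Eigenvalues

variable {p : ℕ} [Fact p.Prime]
variable {V : Type*} [AddCommGroup V] [Module (ZMod p) V] [Fintype V]
variable {W : Type*} {B : LinearMap.BilinForm (ZMod p) V} {F : V → W}

/-- The eigenvalue of the Cayley graph with connection set `E` at the character indexed by `a`.
The Fourier coefficient is real if `E = -E`, the only case of interest; otherwise this is its real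
part. -/
noncomputable def eigenvalue (B : LinearMap.BilinForm (ZMod p) V) (E : Set V) (a : V) : ℝ :=
  (fourier B (ind E) a).re

theorem fourier_ind_eq_eigenvalue {E : Set V} (hE : ∀ x, -x ∈ E ↔ x ∈ E) (a : V) :
    fourier B (ind E) a = eigenvalue B E a :=
  (Complex.conj_eq_iff_re.1 (conj_fourier_ind_of_neg_mem hE a)).symm

omit [Fintype V] in
theorem neg_mem_fiberUnion (heven : ∀ x, F (-x) = F x) (J : Set W) (x : V) :
    -x ∈ fiberUnion F J ↔ x ∈ fiberUnion F J := by
  simp [fiberUnion, heven]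

/-- The nontrivial eigenvalues of a union of classes are roots of one quadratic polynomial, since
the union and its complement form a two-class scheme (a strongly regular graph). -/
theorem exists_quadratic (hB : B.Nondegenerate) (hs : B.IsSymm) (heven : ∀ x, F (-x) = F x)
    (hfus : ∀ 𝓐, IsFusion (relations F) 𝓐 → IsAssociationScheme 𝓐) {J : Set W}
    (hJ : (fiberUnion F J).Nonempty) (hJc : (fiberUnion F Jᶜ).Nonempty) :
    ∃ b c : ℝ, ∀ a, a ≠ 0 → eigenvalue B (fiberUnion F J) a ^ 2
      + b * eigenvalue B (fiberUnion F J) a + c = 0 := by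
  classical
  have h := hfus _ (isFusion_pair hJ hJc)
  rw [← cay_zero] at h
  have hR : cay (fiberUnion F J) ∈ ({cay {0}, cay (fiberUnion F J), cay (fiberUnion F Jᶜ)} :
    Set (Set (V × V))) := Or.inr (Or.inl rfl)
  obtain ⟨k, hk⟩ := h.intersection _ hR _ hR _ (Or.inl rfl)
  obtain ⟨l, hl⟩ := h.intersection _ hR _ hR _ hR
  obtain ⟨u, hu⟩ := h.intersection _ hR _ hR _ (Or.inr (Or.inr rfl))
  rw [hasIntersectionNumber_cay] at hk hl hu
  have hconv : conv (ind (fiberUnion F J)) (ind (fiberUnion F J))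
      = ((k : ℂ) - u) • ind {0} + ((l : ℂ) - u) • ind (fiberUnion F J) + (u : ℂ) • (1 : V → ℂ) := by
    funext x
    rw [conv_ind]
    by_cases hx : x = 0
    · rw [hk x hx]
      simp [ind_apply, hx, fiberUnion]
    · by_cases hxJ : F x ∈ J
      · rw [hl x ⟨hx, hxJ⟩]
        simp [ind_apply, hx, fiberUnion, hxJ]
      · rw [hu x ⟨hx, hxJ⟩]
        simp [ind_apply, hx, fiberUnion, hxJ]
  refine ⟨-((l : ℝ) - u), -((k : ℝ) - u), fun a ha => ?_⟩
  have h1 := fourier_conv (B := B) (ind (fiberUnion F J)) (ind (fiberUnion F J)) a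
  rw [hconv, map_add, map_add, map_smul, map_smul, map_smul] at h1
  simp only [Pi.add_apply, Pi.smul_apply, fourier_one hB hs, ha, if_false, fourier_ind_zero,
    fourier_ind_eq_eigenvalue (neg_mem_fiberUnion heven J), smul_eq_mul] at h1
  have h2 : ((k : ℝ) - u) * 1 + ((l : ℝ) - u) * eigenvalue B (fiberUnion F J) a + u * 0
      = eigenvalue B (fiberUnion F J) a * eigenvalue B (fiberUnion F J) a := by
    exact_mod_cast h1
  linarith

theorem eigenvalue_union {i j : W} (hij : i ≠ j) (a : V) :
    eigenvalue B (fiberUnion F {i, j}) a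
      = eigenvalue B (fiberUnion F {i}) a + eigenvalue B (fiberUnion F {j}) a := by
  classical
  have h : ind (fiberUnion F {i, j}) = ind (fiberUnion F {i}) + ind (fiberUnion F {j}) := by
    funext x
    by_cases hx : x = 0
    · simp [ind_apply, hx, fiberUnion]
    · by_cases hi : F x = i
      · have : F x ≠ j := fun h => hij (hi.symm.trans h)
        simp [ind_apply, hx, fiberUnion, hi, hij]
      · simp [ind_apply, hx, fiberUnion, hi]
  rw [eigenvalue, h, map_add]
  rfl

/-- The eigenvalues of two out of at least three classes are linearly independent modulo constants,
as functions on the nontrivial characters. -/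
theorem eigenvalue_linearIndependent (hB : B.Nondegenerate) (hs : B.IsSymm)
    (heven : ∀ x, F (-x) = F x) {i j k : W} (hi : i ∈ imageStar F) (hj : j ∈ imageStar F)
    (hk : k ∈ imageStar F) (hij : i ≠ j) (hik : i ≠ k) (hjk : j ≠ k) {α β γ : ℝ}
    (h : ∀ a, a ≠ 0 → α + β * eigenvalue B (fiberUnion F {i}) a
      + γ * eigenvalue B (fiberUnion F {j}) a = 0) : β = 0 ∧ γ = 0 := by
  classical
  set f : V → ℂ := (α : ℂ) • ind {0} + (β : ℂ) • ind (fiberUnion F {i})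
    + (γ : ℂ) • ind (fiberUnion F {j}) with hf
  -- The Fourier transform of `f` is supported at the origin, so `f` is constant.
  have h1 : ∀ a, a ≠ 0 → fourier B f a = 0 := by
    intro a ha
    rw [hf, map_add, map_add, map_smul, map_smul, map_smul]
    simp only [Pi.add_apply, Pi.smul_apply, fourier_ind_zero, smul_eq_mul,
      fourier_ind_eq_eigenvalue (neg_mem_fiberUnion heven _)]
    have := h a ha
    rw [mul_one]
    exact_mod_cast this
  have hN : (Fintype.card V : ℂ) ≠ 0 := by simp
  have h2 : f = (fourier B f 0 / Fintype.card V) • (1 : V → ℂ) := by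
    apply fourier_injective hB
    funext a
    rw [map_smul, Pi.smul_apply, fourier_one hB hs, smul_eq_mul]
    by_cases ha : a = 0
    · simp [ha]
    · simp [ha, h1 a ha]
  have h3 : ∀ x y, f x = f y := by
    intro x y
    rw [congrFun h2 x, congrFun h2 y]
    rfl
  obtain ⟨x, hx, rfl⟩ := hi
  obtain ⟨y, hy, rfl⟩ := hj
  obtain ⟨z, hz, rfl⟩ := hk
  have hx0 : x ≠ 0 := hx
  have hy0 : y ≠ 0 := hy
  have hz0 : z ≠ 0 := hz
  constructor
  · have := h3 x z
    simpa [hf, ind_apply, fiberUnion, hx0, hz0, hij, hik.symm, hjk.symm] using this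
  · have := h3 y z
    simpa [hf, ind_apply, fiberUnion, hy0, hz0, hij.symm, hik.symm, hjk.symm] using this

theorem sum_eigenvalue (hB : B.Nondegenerate) (hs : B.IsSymm) [Fintype (imageStar F)] {a : V}
    (ha : a ≠ 0) : ∑ i : imageStar F, eigenvalue B (fiberUnion F {i.1}) a = -1 := by
  classical
  have h : ∑ i : imageStar F, ind (fiberUnion F {i.1}) = (1 : V → ℂ) - ind {0} := by
    funext x
    rw [Finset.sum_apply]
    by_cases hx : x = 0
    · simp [ind_apply, hx, fiberUnion]
    · rw [Finset.sum_eq_single ⟨F x, x, hx, rfl⟩]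
      · simp [ind_apply, hx, fiberUnion]
      · intro i _ hi
        have : F x ≠ i := fun h => hi (Subtype.ext h.symm)
        simp [ind_apply, fiberUnion, this]
      · simp
  simp only [eigenvalue]
  rw [← Complex.re_sum, ← Finset.sum_apply, ← map_sum, h, map_sub, Pi.sub_apply,
    fourier_one hB hs, fourier_ind_zero]
  simp [ha]

/-- The nontrivial eigenvalues of an amorphic translation scheme with at least three classes: up to
scaling and shifts, they are the indicator functions of a partition of the nontrivial
characters. -/
theorem IsAmorphicScheme.exists_eigenvalue_eq {d : ℕ} (hB : B.Nondegenerate) (hs : B.IsSymm)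
    (h : IsAmorphicScheme d (relations F)) (h3 : 3 ≤ (imageStar F).ncard)
    [DecidableEq (imageStar F)] :
    ∃ (D : ℝ) (t : imageStar F → ℝ) (G : {a : V // a ≠ 0} → imageStar F), D ≠ 0 ∧
      ∀ (i : imageStar F) (a : {a : V // a ≠ 0}),
        eigenvalue B (fiberUnion F {i.1}) a.1 = t i + D * if G a = i then 1 else 0 := by
  have heven := h.map_neg h3
  have hfin : (imageStar F).Finite := Set.finite_of_ncard_pos (by omega)
  have := hfin.fintype
  have hthird : ∀ i j : imageStar F, ∃ k : imageStar F, k ≠ i ∧ k ≠ j := by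
    intro i j
    obtain ⟨k, hk, hk'⟩ : ∃ k ∈ imageStar F, k ∉ ({i.1, j.1} : Set W) := by
      apply Set.exists_mem_notMem_of_ncard_lt_ncard _ (by simp)
      exact (Set.ncard_insert_le _ _).trans_lt (by rw [Set.ncard_singleton]; omega)
    simp only [Set.mem_insert_iff, Set.mem_singleton_iff, not_or] at hk'
    exact ⟨⟨k, hk⟩, fun h => hk'.1 (congrArg Subtype.val h),
      fun h => hk'.2 (congrArg Subtype.val h)⟩
  have hnt : Nontrivial (imageStar F) := by
    obtain ⟨i, hi⟩ : (imageStar F).Nonempty := Set.nonempty_of_ncard_ne_zero (by omega)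
    obtain ⟨k, hk, _⟩ := hthird ⟨i, hi⟩ ⟨i, hi⟩
    exact ⟨⟨_, _, hk⟩⟩
  refine exists_eq_add_ite (C := -1)
    (θ := fun (i : imageStar F) (a : {a : V // a ≠ 0}) => eigenvalue B (fiberUnion F {i.1}) a.1)
    ?_ ?_ ?_ ?_
  · intro i
    obtain ⟨k, hk, _⟩ := hthird i i
    obtain ⟨b, c, hbc⟩ := exists_quadratic hB hs heven h.fusion (J := {i.1}) i.2
      (fiberUnion_compl_nonempty k.2 fun h => hk (Subtype.ext h))
    exact ⟨b, c, fun a => hbc a a.2⟩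
  · intro i j hij
    obtain ⟨k, hki, hkj⟩ := hthird i j
    have hij' : i.1 ≠ j.1 := fun h => hij (Subtype.ext h)
    obtain ⟨b, c, hbc⟩ := exists_quadratic hB hs heven h.fusion (J := {i.1, j.1})
      (by
        obtain ⟨x, hx, hxi⟩ := i.2
        exact ⟨x, hx, Or.inl hxi⟩)
      (fiberUnion_compl_nonempty k.2 (by
        rintro (h | h)
        · exact hki (Subtype.ext h)
        · exact hkj (Subtype.ext h)))
    refine ⟨b, c, fun a => ?_⟩
    have := hbc a a.2
    rwa [eigenvalue_union hij'] at this
  · intro i j hij α β γ hl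
    obtain ⟨k, hki, hkj⟩ := hthird i j
    exact eigenvalue_linearIndependent hB hs heven i.2 j.2 k.2 (fun h => hij (Subtype.ext h))
      (fun h => hki (Subtype.ext h.symm)) (fun h => hkj (Subtype.ext h.symm))
      (fun a ha => hl ⟨a, ha⟩)
  · exact fun a => sum_eigenvalue hB hs a.2

end Eigenvalues

/-! ### Parameters of the eigenvalues -/

section Parameters

variable {p : ℕ} [Fact p.Prime]
variable {V : Type*} [AddCommGroup V] [Module (ZMod p) V] [Fintype V]
variable {W : Type*} {B : LinearMap.BilinForm (ZMod p) V} {F : V → W}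

theorem eigenvalue_zero (E : Set V) : eigenvalue B E 0 = E.ncard := by
  rw [eigenvalue, fourier_zero_right, sum_ind]
  simp

theorem sum_eigenvalue_ne_zero (hB : B.Nondegenerate) (heven : ∀ x, F (-x) = F x)
    [Fintype {a : V // a ≠ 0}] (J : Set W) :
    ∑ a : {a : V // a ≠ 0}, eigenvalue B (fiberUnion F J) a = -(fiberUnion F J).ncard := by
  classical
  have h := fourier_inversion hB (ind (fiberUnion F J)) 0
  simp only [map_zero, AddChar.map_zero_eq_one, mul_one,
    fourier_ind_eq_eigenvalue (neg_mem_fiberUnion heven J)] at h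
  rw [ind_of_notMem (fun h => h.1 rfl), mul_zero] at h
  have h1 : ∑ a, eigenvalue B (fiberUnion F J) a = 0 := by exact_mod_cast h
  rw [Fintype.sum_eq_add_sum_subtype_ne _ 0, eigenvalue_zero] at h1
  convert eq_neg_of_add_eq_zero_right h1

/-- Orthogonality of the eigenvalues of distinct classes. -/
theorem sum_eigenvalue_mul_ne_zero (hB : B.Nondegenerate) (heven : ∀ x, F (-x) = F x)
    [Fintype {a : V // a ≠ 0}] {i j : W} (hij : i ≠ j) :
    ∑ a : {a : V // a ≠ 0}, eigenvalue B (fiberUnion F {i}) a * eigenvalue B (fiberUnion F {j}) a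
      = -((fiberUnion F {i}).ncard * (fiberUnion F {j}).ncard) := by
  classical
  have h := parseval hB (ind (fiberUnion F {i})) (ind (fiberUnion F {j}))
  have h0 : ∀ x, ind (fiberUnion F {i}) x * ind (fiberUnion F {j}) (-x) = 0 := by
    intro x
    by_cases hx : F x = i <;> simp [ind_apply, fiberUnion, heven, hx, hij]
  simp only [h0, Finset.sum_const_zero, mul_zero,
    fourier_ind_eq_eigenvalue (neg_mem_fiberUnion heven _)] at h
  have h1 : ∑ a, eigenvalue B (fiberUnion F {i}) a * eigenvalue B (fiberUnion F {j}) a = 0 := by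
    exact_mod_cast h
  rw [Fintype.sum_eq_add_sum_subtype_ne _ 0, eigenvalue_zero, eigenvalue_zero] at h1
  convert eq_neg_of_add_eq_zero_right h1

/-- Eigenvalues are algebraic integers, as sums of roots of unity. -/
theorem isIntegral_eigenvalue (heven : ∀ x, F (-x) = F x) (J : Set W) (a : V) :
    IsIntegral ℤ ((eigenvalue B (fiberUnion F J) a : ℝ) : ℂ) := by
  classical
  rw [← fourier_ind_eq_eigenvalue (neg_mem_fiberUnion heven J), fourier_apply]
  refine IsIntegral.sum _ fun x _ => IsIntegral.mul ?_ ?_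
  · rw [ind_apply]
    split_ifs
    · exact isIntegral_one
    · exact isIntegral_zero
  · refine IsIntegral.of_pow (n := p) (Fact.out : p.Prime).pos ?_
    rw [← AddChar.map_nsmul_eq_pow]
    simp [isIntegral_one]

theorem exists_int_eq_of_isIntegral {x : ℚ} (h : IsIntegral ℤ (x : ℂ)) : ∃ z : ℤ, (z : ℚ) = x := by
  have h1 : IsIntegral ℤ x := by
    rw [← isIntegral_algebraMap_iff (B := ℂ) (algebraMap ℚ ℂ).injective]
    simpa using h
  simpa using IsIntegrallyClosed.isIntegral_iff.1 h1

/-- In the eigenvalues `t i + D * [G a = i]` of the classes, `D = ± √|V|`, the fibers of `G` are as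
large as those of `F`, and the `t i` are determined by the valencies. -/
theorem eigenvalue_parameters (hB : B.Nondegenerate) (heven : ∀ x, F (-x) = F x)
    (h3 : 3 ≤ (imageStar F).ncard) {q : ℕ} (hq : 2 ≤ q) (hV : Fintype.card V = q ^ 2)
    [DecidableEq (imageStar F)] {D : ℝ} {t : imageStar F → ℝ}
    {G : {a : V // a ≠ 0} → imageStar F}
    (hθ : ∀ (i : imageStar F) (a : {a : V // a ≠ 0}),
      eigenvalue B (fiberUnion F {i.1}) a.1 = t i + D * if G a = i then 1 else 0) :
    ∃ σ : ℤ, (σ = 1 ∨ σ = -1) ∧ D = σ * q ∧ Function.Surjective G ∧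
      ∀ i, t i = -(σ * (fiberUnion F {i.1}).ncard / (q - σ)) := by
  classical
  have hfin : (imageStar F).Finite := Set.finite_of_ncard_pos (by omega)
  have := hfin.fintype
  have hq' : (2 : ℝ) ≤ q := by exact_mod_cast hq
  set k : imageStar F → ℝ := fun i => (fiberUnion F {i.1}).ncard with hk
  set g : imageStar F → ℝ := fun i => ∑ a, if G a = i then 1 else 0 with hg
  have hk0 : ∀ i, 0 < k i := by
    intro i
    have : (fiberUnion F {i.1}).Nonempty := i.2
    have h1 := (Set.ncard_pos).2 this
    simp only [hk]
    exact_mod_cast h1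
  have hg0 : ∀ i, 0 ≤ g i := fun i => Finset.sum_nonneg fun a _ => by split_ifs <;> norm_num
  have hN : (Fintype.card {a : V // a ≠ 0} : ℝ) = q ^ 2 - 1 := by
    have h1 := Fintype.card_subtype_compl (fun a : V => a = 0)
    rw [Fintype.card_subtype_eq, hV] at h1
    have h2 : Fintype.card {a : V // a ≠ 0} = q ^ 2 - 1 := by
      convert h1
    rw [h2, Nat.cast_sub (Nat.one_le_pow _ _ (by omega))]
    push_cast
    ring
  have hgsum : ∑ i, g i = q ^ 2 - 1 := by
    rw [hg, Finset.sum_comm]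
    simp [← hN]
  have hlin : ∀ i, (q ^ 2 - 1) * t i + D * g i = -k i := by
    intro i
    have h1 := sum_eigenvalue_ne_zero hB heven {i.1}
    rw [Finset.sum_congr rfl fun a _ => hθ i a, Finset.sum_add_distrib, ← Finset.mul_sum,
      Finset.sum_const, nsmul_eq_mul, Finset.card_univ, hN] at h1
    exact h1
  have hmul : ∀ i j, i ≠ j → (q ^ 2 - 1) * (t i * t j) + D * (t i * g j + t j * g i)
      = -(k i * k j) := by
    intro i j hij
    have h1 := sum_eigenvalue_mul_ne_zero hB heven (B := B) (fun h => hij (Subtype.ext h))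
    rw [← h1, ← hN, ← Finset.card_univ, ← nsmul_eq_mul, ← Finset.sum_const]
    simp only [hg, Finset.mul_sum, ← Finset.sum_add_distrib]
    refine Finset.sum_congr rfl fun a _ => ?_
    rw [hθ, hθ]
    by_cases hi : G a = i
    · simp [hi, hij]
      ring
    · by_cases hj : G a = j
      · simp [hj, hij.symm]
        ring
      · simp [hi, hj]
  -- Eliminating the `t i` from the first moments and the orthogonality relations leaves a relation
  -- between the sizes of the fibers of `F` and `G`.
  have hcross : ∀ i j, i ≠ j → D ^ 2 * (g i * g j) = q ^ 2 * (k i * k j) := by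
    intro i j hij
    have hi := hlin i
    have hj := hlin j
    have e : ((q : ℝ) ^ 2 - 1) * ((q ^ 2 - 1) * (t i * t j) + D * (t i * g j + t j * g i))
        = ((q ^ 2 - 1) * t i + D * g i) * ((q ^ 2 - 1) * t j + D * g j)
          - D ^ 2 * (g i * g j) := by ring
    rw [hmul i j hij, hi, hj] at e
    linear_combination e
  -- The relations for the three pairs from `{i, j, l}` can be solved for `D * g i` up to sign.
  have habs : ∀ i, |D| * g i = q * k i := by
    intro i
    obtain ⟨j, hji, l, hli, hlj⟩ : ∃ j, j ≠ i ∧ ∃ l, l ≠ i ∧ l ≠ j := by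
      have hc : 2 < Fintype.card (imageStar F) := by
        rw [← Nat.card_eq_fintype_card, Nat.card_coe_set_eq]
        omega
      obtain ⟨j, hj⟩ := Fintype.exists_ne_of_one_lt_card (by omega) i
      obtain ⟨l, hl⟩ : ∃ l, l ∉ ({i, j} : Finset (imageStar F)) := by
        by_contra! h
        have h1 := Finset.card_le_card (fun x _ => h x : (Finset.univ : Finset _) ⊆ {i, j})
        rw [Finset.card_univ] at h1
        have := h1.trans Finset.card_le_two
        omega
      simp only [Finset.mem_insert, Finset.mem_singleton, not_or] at hl
      exact ⟨j, hj, l, hl.1, hl.2⟩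
    have e : (D ^ 2 * (g j * g l)) * (D * g i) ^ 2
        = (D ^ 2 * (g i * g j)) * (D ^ 2 * (g i * g l)) := by ring
    rw [hcross j l hlj.symm, hcross i j hji.symm, hcross i l hli.symm] at e
    have hpos : (q : ℝ) ^ 2 * (k j * k l) ≠ 0 := by
      have := hk0 j
      have := hk0 l
      positivity
    have e2 : (D * g i) ^ 2 = (q * k i) ^ 2 := by
      apply mul_left_cancel₀ hpos
      rw [e]
      ring
    have e3 := abs_eq_abs.2 (sq_eq_sq_iff_eq_or_eq_neg.1 e2)
    rwa [abs_mul, abs_of_nonneg (hg0 i), abs_of_nonneg (a := (q : ℝ) * k i)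
      (mul_nonneg (by positivity) (hk0 i).le)] at e3
  have hksum : ∑ i, k i = q ^ 2 - 1 := by
    have h2 : ((Finset.univ : Finset {x : V // x ≠ 0}).card : ℝ) = ∑ i, k i := by
      have h3 : ∀ x : {x : V // x ≠ 0}, x ∈ (Finset.univ : Finset {x : V // x ≠ 0}) →
        (⟨F x, x, x.2, rfl⟩ : imageStar F) ∈ Finset.univ := fun _ _ => Finset.mem_univ _
      rw [Finset.card_eq_sum_card_fiberwise h3, Nat.cast_sum]
      refine Finset.sum_congr rfl fun i _ => ?_
      simp only [hk]
      congr 1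
      rw [← Set.ncard_coe_finset, ← Set.ncard_image_of_injective _ Subtype.val_injective]
      congr 1
      ext x
      simp [fiberUnion, Subtype.ext_iff, and_comm]
    rw [← h2, Finset.card_univ, hN]
  have hDq : |D| = q := by
    have h1 : |D| * ∑ i, g i = q * ∑ i, k i := by
      rw [Finset.mul_sum, Finset.mul_sum]
      exact Finset.sum_congr rfl fun i _ => habs i
    rw [hgsum, hksum] at h1
    exact mul_right_cancel₀ (by nlinarith) h1
  have hgk : ∀ i, g i = k i := by
    intro i
    have := habs i
    rw [hDq] at this
    exact mul_left_cancel₀ (by linarith) this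
  have hsurj : Function.Surjective G := by
    intro i
    by_contra! h
    have h1 : g i = 0 := by simp [hg, h]
    rw [hgk] at h1
    exact (hk0 i).ne' h1
  have hfinal : ∀ σ : ℤ, (σ = 1 ∨ σ = -1) → D = σ * q →
      ∀ i, t i = -(σ * (fiberUnion F {i.1}).ncard / (q - σ)) := by
    intro σ hσ hDσ i
    have hσ2 : (σ : ℝ) * σ = 1 := by rcases hσ with rfl | rfl <;> norm_num
    have hσ1 : (q : ℝ) - σ ≠ 0 ∧ (q : ℝ) + σ ≠ 0 := by
      rcases hσ with rfl | rfl <;> push_cast <;> constructor <;> linarith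
    have h1 := hlin i
    rw [hgk, hDσ] at h1
    rw [← neg_div, eq_div_iff hσ1.1]
    apply mul_left_cancel₀ hσ1.2
    simp only [hk] at h1
    linear_combination h1 + ((fiberUnion F {i.1}).ncard - t i) * hσ2
  rcases abs_eq (by positivity) |>.1 hDq with h | h
  · exact ⟨1, Or.inl rfl, by simp [h], hsurj, hfinal 1 (Or.inl rfl) (by simp [h])⟩
  · exact ⟨-1, Or.inr rfl, by simp [h], hsurj, hfinal (-1) (Or.inr rfl) (by simp [h])⟩

end Parameters

/-! ### From amorphic schemes to dual pairs -/

section Valencies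

variable {V W : Type*} [AddCommGroup V] {F : V → W}

theorem IsPrescribedScheme.map_neg {p n m : ℕ} {ε : ℤ} (h : IsPrescribedScheme p n m F ε) (x : V) :
    F (-x) = F x :=
  h.isAmorphicScheme.map_neg h.three_le x

theorem IsPrescribedScheme.valency {p n m : ℕ} {ε : ℤ} (h : IsPrescribedScheme p n m F ε) {i : W}
    (hi : i ∈ imageStar F) : ((fiberUnion F {i}).ncard : ℤ)
      = (p : ℤ) ^ (n - m) - ε * (p : ℤ) ^ (n / 2 - m)
        + Set.indicator {F 0} 1 i * (ε * (p : ℤ) ^ (n / 2) - 1) := by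
  obtain ⟨k, hk, hk'⟩ := h.intersection i hi
  rw [← hk', (hasIntersectionNumber_diagonal h.map_neg).1 hk]

end Valencies

section Converse

variable {p : ℕ} [Fact p.Prime]
variable {V : Type*} [AddCommGroup V] [Module (ZMod p) V] [Fintype V]
variable {W : Type*} [Fintype W]
variable {B : LinearMap.BilinForm (ZMod p) V} {F : V → W}

/-- A scheme with the prescribed valencies comes from a dual pair: the eigenvalues determine the
dual of `F` away from the origin, where it is given the value `F 0`. -/
theorem IsPrescribedScheme.exists_isDualPair {n m : ℕ} (hn : 4 ≤ n) (hn_even : Even n)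
    (hm : 2 ≤ m) (hmn : m ≤ n / 2) (hV : Fintype.card V = p ^ n) (hW : Fintype.card W = p ^ m)
    (hB : B.Nondegenerate) (hs : B.IsSymm) {ε : ℤ} (h : IsPrescribedScheme p n m F ε) :
    ∃ G, IsDualPair B F G (ε * (p : ℝ) ^ (n / 2)) := by
  classical
  have : Nonempty W := ⟨F 0⟩
  have hp : 2 ≤ p := (Fact.out : p.Prime).two_le
  have heven := h.map_neg
  obtain ⟨hI1, hI2⟩ := imageStar_of_valencies hn hn_even hm hmn hV hW h.eps h.eps_eq_one
    (fun i => h.valency)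
  set q : ℕ := p ^ (n / 2) with hq
  set r : ℕ := p ^ (n / 2 - m) with hr
  set M : ℕ := p ^ m with hM
  have hqM : q = M * r := by rw [hq, hM, hr, ← pow_add]; congr 1; omega
  have hrq : p ^ (n - m) = r * q := by
    rw [hq, hr, ← pow_add]
    congr 1
    obtain ⟨_, rfl⟩ := hn_even
    omega
  have hNq : Fintype.card V = q ^ 2 := by
    rw [hV, hq, ← pow_mul]
    congr 1
    obtain ⟨_, rfl⟩ := hn_even
    omega
  have hr0 : 1 ≤ r := Nat.one_le_pow _ _ (by omega)
  have hM4 : 4 ≤ M := by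
    calc 4 = 2 ^ 2 := by norm_num
      _ ≤ p ^ 2 := by gcongr
      _ ≤ M := pow_le_pow_right₀ (by omega) hm
  have hq4 : 4 ≤ q := by nlinarith
  -- The formula for the valencies also holds for the value that may be missing in the image.
  have hval : ∀ i, ((fiberUnion F {i}).ncard : ℤ)
      = r * (q - ε) + (if F 0 = i then 1 else 0) * (ε * q - 1) := by
    intro i
    have e : Set.indicator {F 0} (1 : W → ℤ) i = if F 0 = i then 1 else 0 := by
      simp [Set.indicator_apply, eq_comm]
    by_cases hi : i ∈ imageStar F
    · have h1 := h.valency hi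
      rw [e] at h1
      have h2 : (p : ℤ) ^ (n - m) = r * q := by exact_mod_cast hrq
      rw [h1, h2, hq, hr]
      push_cast
      ring
    · have hex : p = 3 ∧ n = 2 * m ∧ ε = -1 := by
        by_contra hex
        rw [(hI1 hex).1] at hi
        exact hi (Set.mem_univ _)
      have hi0 : F 0 = i := by
        rw [(hI2 hex).1] at hi
        simpa [eq_comm] using hi
      have hr1 : r = 1 := by
        rw [hr, show n / 2 - m = 0 by omega, pow_zero]
      have h0 : (fiberUnion F {i}).ncard = 0 := by
        rw [Set.ncard_eq_zero, ← Set.not_nonempty_iff_eq_empty]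
        exact hi
      rw [h0, hr1, hex.2.2, if_pos hi0]
      push_cast
      ring
  obtain ⟨D, t, G, -, hθ⟩ := h.isAmorphicScheme.exists_eigenvalue_eq hB hs h.three_le
  obtain ⟨σ, hσ, rfl, hG, ht⟩ :=
    eigenvalue_parameters hB heven h.three_le (by omega : 2 ≤ q) hNq hθ
  -- The sign is right, as the eigenvalues would not be algebraic integers otherwise.
  have hσε : σ = ε := by
    by_contra hne
    have hσ' : σ = -ε := by
      rcases hσ with h1 | h1 <;> rcases h.eps with h2 | h2 <;> omega
    obtain ⟨i, hi, hi0⟩ : ∃ i ∈ imageStar F, i ∉ ({F 0} : Set W) :=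
      Set.exists_mem_notMem_of_ncard_lt_ncard
        (by rw [Set.ncard_singleton]; have := h.three_le; omega) (by simp)
    obtain ⟨j, hj, hji⟩ : ∃ j ∈ imageStar F, j ∉ ({i} : Set W) :=
      Set.exists_mem_notMem_of_ncard_lt_ncard
        (by rw [Set.ncard_singleton]; have := h.three_le; omega) (by simp)
    obtain ⟨a, ha⟩ := hG ⟨j, hj⟩
    have hti : eigenvalue B (fiberUnion F {i}) a.1 = t ⟨i, hi⟩ := by
      rw [hθ ⟨i, hi⟩ a, ha, if_neg (fun h : (⟨j, hj⟩ : imageStar F) = ⟨i, hi⟩ =>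
        hji (congrArg Subtype.val h)), mul_zero, add_zero]
    have hint := isIntegral_eigenvalue (B := B) heven {i} a.1
    rw [hti, ht] at hint
    obtain ⟨z, hz⟩ := exists_int_eq_of_isIntegral
      (x := -(σ * (fiberUnion F {i}).ncard / (q - σ))) (by
        push_cast at hint ⊢
        exact hint)
    have hvi := hval i
    rw [if_neg (fun h => hi0 h.symm), zero_mul, add_zero] at hvi
    have hε2 : ε * ε = 1 := by rcases h.eps with h | h <;> rw [h] <;> norm_num
    have hqε : (q : ℤ) - σ ≠ 0 := by
      rcases hσ with h | h <;> rw [h] <;> omega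
    have hz2 : z * ((q : ℤ) - σ) = -(σ * (fiberUnion F {i}).ncard) := by
      have h1 : ((q : ℚ) - σ) ≠ 0 := by exact_mod_cast hqε
      rw [← neg_div, eq_div_iff h1] at hz
      exact_mod_cast hz
    rw [hvi, hσ'] at hz2
    have hdvd : (q : ℤ) + ε ∣ 2 * r := by
      -- `q + ε` divides `r * (q - ε) = r * (q + ε) - 2 * ε * r`.
      refine ⟨ε * r - z, ?_⟩
      linear_combination hz2 - 2 * r * hε2
    have hle := Int.le_of_dvd (by positivity) hdvd
    have h1 : (q : ℤ) = M * r := by exact_mod_cast hqM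
    have h2 : (4 : ℤ) ≤ M := by exact_mod_cast hM4
    have h3 : (1 : ℤ) ≤ r := by exact_mod_cast hr0
    rcases h.eps with h | h <;> rw [h] at hle <;> nlinarith
  subst hσε
  have hσ2 : (σ : ℂ) * σ = 1 := by rcases hσ with h | h <;> rw [h] <;> norm_num
  have hqσ : (q : ℂ) - σ ≠ 0 := by
    have : (q : ℤ) - σ ≠ 0 := by rcases hσ with h | h <;> rw [h] <;> omega
    exact_mod_cast this
  have hMC : (M : ℂ) ≠ 0 := by
    have : M ≠ 0 := by omega
    exact_mod_cast this
  have hqC : (q : ℂ) = M * r := by exact_mod_cast hqM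
  have hvalC : ∀ i, ((fiberUnion F {i}).ncard : ℂ)
      = r * (q - σ) + (if F 0 = i then 1 else 0) * (σ * q - 1) := by
    intro i
    have := hval i
    split_ifs at this ⊢ <;> exact_mod_cast this
  have heig : ∀ i (a : V) (ha : a ≠ 0), fourier B (ind (fiberUnion F {i})) a
      = σ * q * (if (G ⟨a, ha⟩ : W) = i then 1 else 0)
        - σ * (fiberUnion F {i}).ncard / (q - σ) := by
    intro i a ha
    by_cases hi : i ∈ imageStar F
    · rw [fourier_ind_eq_eigenvalue (neg_mem_fiberUnion heven _), hθ ⟨i, hi⟩ ⟨a, ha⟩, ht]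
      simp only [Subtype.ext_iff]
      split_ifs <;> push_cast <;> ring
    · have h0 : fiberUnion F {i} = ∅ := Set.not_nonempty_iff_eq_empty.1 hi
      have h1 : ind (∅ : Set V) = 0 := by
        funext x
        simp [ind]
      rw [h0, h1, map_zero, if_neg (fun h : (G ⟨a, ha⟩ : W) = i => hi (h ▸ (G ⟨a, ha⟩).2))]
      simp
  refine ⟨fun a => if ha : a = 0 then F 0 else (G ⟨a, ha⟩ : W), isDualPair_of_bal fun i a => ?_⟩
  have e : bal {i} ∘ F = ind (fiberUnion F {i}) + (if F 0 = i then (1 : ℂ) else 0) • ind {0}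
      - ((1 : ℂ) / M) • (1 : V → ℂ) := by
    funext x
    simp only [Pi.sub_apply, Pi.add_apply, Pi.smul_apply, Pi.one_apply, smul_eq_mul,
      ind_fiberUnion F {i} x, hW, Set.ncard_singleton]
    rw [ind_apply {i} (F 0)]
    simp only [Set.mem_singleton_iff]
    push_cast
    ring
  rw [e, map_sub, map_add, map_smul, map_smul, Pi.sub_apply, Pi.add_apply, Pi.smul_apply,
    Pi.smul_apply, fourier_one hB hs, fourier_ind_zero, hNq]
  by_cases ha : a = 0
  · simp only [ha, fourier_zero_right, sum_ind, hvalC, if_true, dif_pos]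
    simp only [bal, ind_apply, hW, Set.mem_singleton_iff, Set.ncard_singleton, smul_eq_mul]
    push_cast
    rw [← Nat.cast_pow p, ← hq, hqC]
    split_ifs <;> field_simp <;> ring
  · rw [heig i a ha]
    simp only [ha, hvalC, if_false, dif_neg, not_false_eq_true, bal, ind_apply, hW,
      Set.mem_singleton_iff, Set.ncard_singleton, smul_eq_mul]
    push_cast
    rw [← Nat.cast_pow p, ← hq]
    have e2 : ∀ δ : ℂ, (σ : ℂ) * (r * (q - σ) + δ * (σ * q - 1)) / (q - σ) = σ * r + δ := by
      intro δ
      rw [div_eq_iff hqσ]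
      linear_combination (δ * q) * hσ2
    rw [e2, hqC]
    field_simp
    ring

end Converse

/-! ### Condition A in terms of dual pairs -/

section ConditionA

variable {p : ℕ} [Fact p.Prime]
variable {V : Type*} [AddCommGroup V] [Module (ZMod p) V] [Fintype V]
variable {W : Type*} [AddCommGroup W] [Module (ZMod p) W]
variable {B : LinearMap.BilinForm (ZMod p) V} {B' : LinearMap.BilinForm (ZMod p) W} {F G : V → W}

omit [Fintype V] in
theorem rootCard_eq {n : ℕ} (hV : Module.finrank (ZMod p) V = n) (hn : Even n) :
    rootCard p V = (p : ℝ) ^ (n / 2) := by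
  obtain ⟨k, rfl⟩ := hn
  rw [rootCard, hV, ← Real.rpow_natCast]
  congr 1
  rw [show (k + k) / 2 = k by omega]
  push_cast
  ring

omit [Fintype V] in
theorem rootCard_pos : 0 < rootCard p V := by
  have : 0 < p := (Fact.out : p.Prime).pos
  unfold rootCard
  positivity

/-- The functions of zero sum on `W` are the linear combinations of the nontrivial characters. -/
theorem isDualPair_iff_walsh [Fintype W] (hB' : B'.Nondegenerate) (hs' : B'.IsSymm) {κ : ℝ} :
    IsDualPair B F G κ ↔
      ∀ c, c ≠ 0 → ∀ a, walsh B (component B' F c) a = κ * ZMod.stdAddChar (B' c (G a)) := by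
  classical
  constructor
  · intro H c hc a
    rw [walsh_eq_fourier]
    refine H (fun w => ZMod.stdAddChar (B' c w)) ?_ a
    have h := sum_stdAddChar hB' c
    rw [if_neg hc] at h
    rw [← h]
    exact Finset.sum_congr rfl fun w _ => by rw [hs'.eq c w]
  · intro H h h0 a
    have hM : (Fintype.card W : ℂ) ≠ 0 := by simp
    have hinv : ∀ w, h w
        = ∑ c, ((1 / Fintype.card W : ℂ) * fourier B' h c) * ZMod.stdAddChar (B' c w) := by
      intro w
      simp only [mul_assoc]
      rw [← Finset.mul_sum, fourier_inversion hB', ← mul_assoc, one_div_mul_cancel hM, one_mul]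
    have e : h ∘ F = ∑ c, ((1 / Fintype.card W : ℂ) * fourier B' h c) •
        (fun x => (ZMod.stdAddChar (component B' F c x) : ℂ)) := by
      funext x
      rw [Finset.sum_apply]
      exact hinv (F x)
    rw [e, map_sum, Finset.sum_apply, hinv (G a), Finset.mul_sum]
    refine Finset.sum_congr rfl fun c _ => ?_
    rw [map_smul, Pi.smul_apply, ← walsh_eq_fourier, smul_eq_mul]
    by_cases hc : c = 0
    · have : fourier B' h 0 = 0 := by rw [fourier_zero_right, h0]
      simp [hc, this]
    · rw [H c hc]
      ring

omit [Fact p.Prime] in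
theorem mem_signs_iff {n : ℕ} (hn : Even n) {ξ : ℂ} :
    ξ ∈ signs p n ↔ (ξ = 1 ∨ ξ = -1) ∧ (p = 2 → ξ = 1) := by
  unfold signs
  by_cases h2 : p = 2
  · simp +contextual [h2]
  · simp [h2, hn]

/-- The exponent in the value of a Walsh transform is unique, so it is the value of the dual. -/
theorem dual_eq (hn : Even (Module.finrank (ZMod p) V)) {f : V → ZMod p} {a : V} {ξ : ℂ}
    {j : ZMod p} (hξ : ξ ∈ signs p (Module.finrank (ZMod p) V))
    (h : walsh B f a = ξ * (rootCard p V : ℂ) * ZMod.stdAddChar j) : dual B f a = j := by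
  have hspec := Classical.epsilon_spec (p := fun j : ZMod p =>
    ∃ ξ ∈ signs p (Module.finrank (ZMod p) V),
      walsh B f a = ξ * (rootCard p V : ℂ) * ZMod.stdAddChar j) ⟨j, ξ, hξ, h⟩
  obtain ⟨ξ', hξ', h'⟩ := hspec
  change walsh B f a = ξ' * (rootCard p V : ℂ) * ZMod.stdAddChar (dual B f a) at h'
  set j' := dual B f a
  have hq : (rootCard p V : ℂ) ≠ 0 := by exact_mod_cast rootCard_pos.ne'
  have e : ξ' * ZMod.stdAddChar j' = ξ * ZMod.stdAddChar j := by
    apply mul_left_cancel₀ hq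
    linear_combination h - h'
  rw [mem_signs_iff hn] at hξ hξ'
  by_cases hξξ : ξ' = ξ
  · have hξ0 : ξ ≠ 0 := by rcases hξ.1 with h | h <;> rw [h] <;> norm_num
    rw [hξξ] at e
    exact ZMod.injective_stdAddChar (mul_left_cancel₀ hξ0 e)
  · -- Otherwise `-1` would be a `p`-th root of unity for an odd `p`.
    exfalso
    have hp2 : p ≠ 2 := fun h => hξξ ((hξ'.2 h).trans (hξ.2 h).symm)
    have hodd : Odd p := (Fact.out : p.Prime).odd_of_ne_two hp2
    have hpow : ∀ k : ZMod p, (ZMod.stdAddChar k : ℂ) ^ p = 1 := by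
      intro k
      rw [← AddChar.map_nsmul_eq_pow]
      simp
    have e2 := congrArg (· ^ p) e
    simp only [mul_pow, hpow, mul_one] at e2
    rcases hξ.1 with h1 | h1 <;> rcases hξ'.1 with h2 | h2 <;> rw [h1, h2] at hξξ e2 <;>
      simp [hodd.neg_one_pow] at hξξ e2 <;> norm_num at e2

/-- The zero function is not bent, its Walsh transform being supported at the origin. -/
theorem component_ne_zero [Nontrivial V] (hB : B.Nondegenerate) (hs : B.IsSymm)
    (hG : IsVectorialBent B B' G) {c : W} (hc : c ≠ 0) : component B' G c ≠ 0 := by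
  intro h
  obtain ⟨a, ha⟩ := exists_ne (0 : V)
  have h1 := hG c hc a
  have h2 : (fun x => (ZMod.stdAddChar ((0 : V → ZMod p) x) : ℂ)) = 1 := by
    funext x
    simp
  rw [h, walsh_eq_fourier, h2, fourier_one hB hs, if_neg ha, norm_zero] at h1
  exact rootCard_pos.ne h1

theorem isVectorialBent_of_walsh {ε : ℤ} (hε : ε = 1 ∨ ε = -1)
    (h : ∀ c, c ≠ 0 → ∀ a, walsh B (component B' F c) a
      = (ε * rootCard p V : ℝ) * ZMod.stdAddChar (B' c (G a))) : IsVectorialBent B B' F := by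
  intro c hc a
  rw [h c hc a, norm_mul, AddChar.norm_apply, mul_one, Complex.norm_real, norm_mul,
    Real.norm_of_nonneg rootCard_pos.le]
  rcases hε with h | h <;> simp [h]

/-- Condition A amounts to the existence of a dual pair: the duals of the components are the
components of the second function, hence form the image of `W` under a linear injection. -/
theorem hasConditionAWith_iff [Fintype W] [Nontrivial V] [Nontrivial W] (hB : B.Nondegenerate)
    (hs : B.IsSymm) (hB' : B'.Nondegenerate) (hs' : B'.IsSymm) {n : ℕ}
    (hV : Module.finrank (ZMod p) V = n) (hn : Even n) (ε : ℤ) :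
    HasConditionAWith B B' F ε ↔ (ε = 1 ∨ ε = -1) ∧ (p = 2 → ε = 1) ∧
      ∃ G, IsDualPair B F G (ε * (p : ℝ) ^ (n / 2)) := by
  have hsign : (ε : ℂ) ∈ signs p (Module.finrank (ZMod p) V)
      ↔ (ε = 1 ∨ ε = -1) ∧ (p = 2 → ε = 1) := by
    rw [mem_signs_iff (by rwa [hV])]
    norm_cast
  simp only [← rootCard_eq hV hn]
  constructor
  · intro h
    obtain ⟨c, hc⟩ := exists_ne (0 : W)
    obtain ⟨h1, h2⟩ := hsign.1 (h.isWeaklyRegular c hc).mem_signs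
    obtain ⟨G, _, hG⟩ := h.exists_dual
    refine ⟨h1, h2, G, (isDualPair_iff_walsh hB' hs').2 fun c hc a => ?_⟩
    rw [(h.isWeaklyRegular c hc).walsh_eq a, hG c hc]
    push_cast
    rfl
  · rintro ⟨h1, h2, G, H⟩
    have hmem := hsign.2 ⟨h1, h2⟩
    have hκ : (ε * rootCard p V) ^ 2 = Fintype.card V := by
      have e : ((ε : ℝ)) ^ 2 = 1 := by rcases h1 with h | h <;> rw [h] <;> norm_num
      rw [mul_pow, e, one_mul, rootCard_eq hV hn, Module.card_eq_pow_finrank (K := ZMod p), hV,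
        ZMod.card, ← pow_mul, Nat.div_mul_cancel hn.two_dvd]
      norm_cast
    have hF := (isDualPair_iff_walsh hB' hs').1 H
    have hbF : IsVectorialBent B B' F := isVectorialBent_of_walsh h1 hF
    have hbG : IsVectorialBent B B' G :=
      isVectorialBent_of_walsh h1 ((isDualPair_iff_walsh hB' hs').1 (H.symm hB hs hκ))
    have hdual : ∀ c, c ≠ 0 → dual B (component B' F c) = component B' G c := by
      intro c hc
      funext a
      refine dual_eq (by rwa [hV]) hmem ?_
      rw [hF c hc]
      push_cast
      rfl
    refine ⟨⟨hbF, ?_⟩, ⟨G, hbG, hdual⟩, fun c hc => ⟨hbF c hc, hmem, fun a => ?_⟩⟩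
    · let L : W →ₗ[ZMod p] (V → ZMod p) :=
        { toFun := fun c => component B' G c
          map_add' := fun c d => by
            funext x
            simp [component]
          map_smul' := fun r c => by
            funext x
            simp [component] }
      have hL : ∀ c, L c = component B' G c := fun _ => rfl
      have hLinj : Function.Injective L := by
        rw [injective_iff_map_eq_zero]
        intro c hc
        by_contra hne
        exact component_ne_zero hB hs hbG hne hc
      refine ⟨LinearMap.range L, ?_, LinearMap.finrank_range_of_inj hLinj, ?_⟩
      · ext g
        constructor
        · rintro ⟨c, rfl⟩
          by_cases hc : c = 0
          · exact Or.inl (by rw [hc, map_zero])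
          · exact Or.inr ⟨c, hc, (hdual c hc).symm⟩
        · rintro (rfl | ⟨c, hc, rfl⟩)
          · exact Submodule.zero_mem _
          · exact ⟨c, (hdual c hc).symm⟩
      · rintro _ ⟨c, rfl⟩ hne
        exact hbG c fun hc => hne (by rw [hc, map_zero])
    · rw [hdual c hc, hF c hc]
      push_cast
      rfl

end ConditionA

end VDB

theorem theorem1 {p : ℕ} [Fact p.Prime] {n m : ℕ} (hn : 4 ≤ n) (hn_even : Even n)
    (hm : 2 ≤ m) (hmn : m ≤ n / 2)
    {V : Type*} [AddCommGroup V] [Module (ZMod p) V] [Fintype V]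
    {W : Type*} [AddCommGroup W] [Module (ZMod p) W]
    (hV : Module.finrank (ZMod p) V = n) (hW : Module.finrank (ZMod p) W = m)
    (B : LinearMap.BilinForm (ZMod p) V) (hB : B.Nondegenerate) (hB_symm : B.IsSymm)
    (B' : LinearMap.BilinForm (ZMod p) W) (hB' : B'.Nondegenerate) (hB'_symm : B'.IsSymm)
    (F : V → W) :
    (VDB.HasConditionA B B' F ↔ ∃ ε : ℤ, VDB.IsPrescribedScheme p n m F ε) ∧
    ∀ ε : ℤ,
      (VDB.HasConditionAWith B B' F (ε : ℂ) ↔ VDB.IsPrescribedScheme p n m F ε) ∧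
      (VDB.HasConditionAWith B B' F (ε : ℂ) ∨ VDB.IsPrescribedScheme p n m F ε →
        (¬ (p = 3 ∧ n = 2 * m ∧ ε = -1) →
          VDB.imageStar F = Set.univ ∧ (VDB.imageStar F).ncard = p ^ m) ∧
        (p = 3 ∧ n = 2 * m ∧ ε = -1 →
          VDB.imageStar F = {F 0}ᶜ ∧ (VDB.imageStar F).ncard = 3 ^ m - 1)) := by
  have : Nontrivial V := Module.nontrivial_of_finrank_pos (R := ZMod p) (by omega)
  have : Nontrivial W := Module.nontrivial_of_finrank_pos (R := ZMod p) (by omega)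
  have : Module.Finite (ZMod p) W := Module.finite_of_finrank_pos (by omega)
  have : Finite W := Module.finite_of_finite (ZMod p)
  have : Fintype W := Fintype.ofFinite W
  have hVc : Fintype.card V = p ^ n := by
    rw [Module.card_eq_pow_finrank (K := ZMod p), hV, ZMod.card]
  have hWc : Fintype.card W = p ^ m := by
    rw [Module.card_eq_pow_finrank (K := ZMod p), hW, ZMod.card]
  have key : ∀ ε : ℤ,
      VDB.HasConditionAWith B B' F (ε : ℂ) ↔ VDB.IsPrescribedScheme p n m F ε := by
    intro ε
    rw [VDB.hasConditionAWith_iff hB hB_symm hB' hB'_symm hV hn_even]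
    constructor
    · rintro ⟨h1, h2, G, H⟩
      exact H.isPrescribedScheme hn hn_even hm hmn hVc hWc hB hB_symm h1 h2
    · intro h
      exact ⟨h.eps, fun h2 => h.eps_eq_one (by omega),
        h.exists_isDualPair hn hn_even hm hmn hVc hWc hB hB_symm⟩
  refine ⟨⟨?_, fun ⟨ε, h⟩ => ⟨ε, (key ε).2 h⟩⟩, fun ε => ⟨key ε, fun h => ?_⟩⟩
  · rintro ⟨ε, h⟩
    obtain ⟨c, hc⟩ := exists_ne (0 : W)
    have hsign := (h.isWeaklyRegular c hc).mem_signs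
    rw [hV, VDB.mem_signs_iff hn_even] at hsign
    rcases hsign.1 with rfl | rfl
    · exact ⟨1, (key 1).1 (by simpa using h)⟩
    · exact ⟨-1, (key (-1)).1 (by simpa using h)⟩
  · have h' : VDB.IsPrescribedScheme p n m F ε := h.elim (key ε).1 id
    exact VDB.imageStar_of_valencies hn hn_even hm hmn hVc hWc h'.eps h'.eps_eq_one
      fun i => h'.valency
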